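/- **Setting.** Let $\mathbf V$ be a finite set of random variables. Each $V_i\in\mathbf V$ takes values in a measurable space with a $\sigma$-finite reference measure; densities are taken with respect to the product reference measure, and identities between densities hold almost everywhere. A *causal model* (structural equation model) over $\mathbf V$ is a set of equations, one for each $V_i$, expressing $V_i$ as a function of its causal determinants and of random noise, where the edges $V_j\to V_i$ ($V_j$ a causal determinant of $V_i$) form a directed acyclic graph (DAG) $\mathcal D$. Let $f(\mathbf v\mid do(\mathbf s))$, for $\mathbf S\subseteq\mathbf V$, be the densities of the variables when the variables in $\mathbf S$ are set to $\mathbf s$, with $f(\mathbf v)$ the observational density ($\mathbf S=\emptyset$). It is assumed that $f(\mathbf v)>0$; that the densities are *consistent* with $\mathcal D$, i.e. for all $\mathbf S\subseteq\mathbf V$ $$f(\mathbf v\mid do(\mathbf s))=\prod_{V_i\in\mathbf V\setminus\mathbf S} f\big(v_i\mid \mathrm{pa}(v_i,\mathcal D)\big)\,\mathbb 1(\mathbf S=\mathbf s);$$ and that $f(\mathbf v)$ is *faithful* to $\mathcal D$, i.e. for pairwise disjoint $\mathbf A,\mathbf B,\mathbf C\subseteq\mathbf V$, if $\mathbf A\perp\!\!\!\perp\mathbf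 B\mid\mathbf C$ under $f$, then $\mathbf A$ and $\mathbf B$ are d-separated given $\mathbf C$ in $\mathcal D$. For pairwise disjoint $\mathbf X,\mathbf Y,\mathbf Z\subseteq\mathbf V$, the set $\mathbf Z$ is an *adjustment set* relative to $(\mathbf X,\mathbf Y)$ if $g(\mathbf y\mid do(\mathbf x))=\int g(\mathbf y\mid\mathbf x,\mathbf z)\,g(\mathbf z)\,d\mathbf z$ for every family $g$ of interventional densities (with positive observational density, for any value spaces and reference measures) that is consistent with $\mathcal D$. It is a *minimal adjustment set* if in addition no proper subset of $\mathbf Z$ is an adjustment set relative to $(\mathbf X,\mathbf Y)$. We write $\mathbf T<X$ if $X$ is not an ancestor in $\mathcal D$ of any element of $\mathbf T$. All (in)dependences below refer to the observational density $f$ of the model. **Lemma (Probabilistic criteria for minimality).** Let $\mathbf T$ be an adjustment set relative to $(X,Y)$, for single variables $X,Y$, in a causal model where $\mathbf T<X$. Then $\mathbf T$ is a minimal adjustment set relative to $(X,Y)$ if and only if for all $T\in\mathbf T$, 1. $X\not\!\perp\!\!\!\perp T\mid\mathbf T\setminus\{T\}$, and 2. $Y\not\!\perp\!\!\!\perp T\mid(\mathbf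 T\setminus\{T\})\cup\{X\}$. Otherwise (if $\mathbf T$ is not minimal), a proper subset $\mathbf Z\subset\mathbf T$ is a minimal adjustment set relative to $(X,Y)$ if for all $Z\in\mathbf Z$, 3. $X\not\!\perp\!\!\!\perp Z\mid\mathbf Z\setminus\{Z\}$, and 4. $Y\not\!\perp\!\!\!\perp Z\mid(\mathbf Z\setminus\{Z\})\cup\{X\}$, and, in addition (also when $\mathbf Z=\emptyset$), 5. $Y\perp\!\!\!\perp\mathbf T\mid\mathbf Z\cup\{X\}$ or $X\perp\!\!\!\perp\mathbf T\mid\mathbf Z$. -/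

import Mathlib

open MeasureTheory
open scoped ENNReal

universe v u

/-- A directed acyclic graph on the node set `V`; `D.Adj i j` is the edge `i → j`. -/
structure DAG (V : Type v) extends Digraph V where
  acyclic : ∀ i, ¬ Relation.TransGen Adj i i

namespace DAG

variable {V : Type v} (D : DAG V)

/-- There is a directed path (possibly of length zero) from `i` to `j`. -/
def IsAncestor (i j : V) : Prop := Relation.ReflTransGen D.Adj i j

/-- `S < S'`: no element of `S'` is an ancestor of an element of `S`. -/
def Precedes (S S' : Finset V) : Prop := ∀ i ∈ S, ∀ j ∈ S', ¬ D.IsAncestor j i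

/-- A path: a nonempty sequence of distinct nodes, successive ones joined by an edge in either
direction. -/
structure IsPath (p : List V) : Prop where
  ne_nil : p ≠ []
  nodup : p.Nodup
  chain : p.IsChain (fun i j => D.Adj i j ∨ D.Adj j i)

/-- `p` is a path from the node set `A` to the node set `B`. -/
def IsPathBetween (A B : Finset V) (p : List V) : Prop :=
  D.IsPath p ∧ (∃ a ∈ A, p.head? = some a) ∧ (∃ b ∈ B, p.getLast? = some b)

/-- `… a → b ← c …` occurs on `p`. -/
def IsCollider (p : List V) (b : V) : Prop :=
  ∃ a c, [a, b, c] <:+: p ∧ D.Adj a b ∧ D.Adj c b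

/-- `… a ← b … c …` or `… a … b → c …` occurs on `p`. -/
def IsNonCollider (p : List V) (b : V) : Prop :=
  ∃ a c, [a, b, c] <:+: p ∧ (D.Adj b a ∨ D.Adj b c)

/-- The path `p` is d-connecting given `C`. -/
def IsOpen (p : List V) (C : Finset V) : Prop :=
  (∀ b, D.IsNonCollider p b → b ∉ C) ∧
    (∀ b, D.IsCollider p b → ∃ c ∈ C, D.IsAncestor b c)

/-- `A` and `B` are d-separated given `C`. -/
def DSep (A B C : Finset V) : Prop := ∀ p, D.IsPathBetween A B p → ¬ D.IsOpen p C

open Classical in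
/-- The set of parents of `i`. -/
noncomputable def parents [Fintype V] (i : V) : Finset V :=
  Finset.univ.filter (fun j => D.Adj j i)

theorem wellFounded_adj [Finite V] : WellFounded D.Adj := by
  have : Std.Irrefl (Relation.TransGen D.Adj) := ⟨D.acyclic⟩
  have h : WellFounded (Relation.TransGen D.Adj) := Finite.wellFounded_of_trans_of_irrefl _
  exact Subrelation.wf (fun h => Relation.TransGen.single h) h

end DAG

section Densities

variable {V : Type v} [Fintype V] [DecidableEq V] {Ω : V → Type u}
  [∀ i, MeasurableSpace (Ω i)]

/-- The marginal density of the variables in `S`, as a function of `v` through `(v i)_{i ∈ S}`: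
all other coordinates are integrated out against the reference measures `μ`. -/
noncomputable def marginalDensity (μ : ∀ i, Measure (Ω i)) (f : (∀ i, Ω i) → ℝ≥0∞)
    (S : Finset V) : (∀ i, Ω i) → ℝ≥0∞ :=
  lmarginal μ Sᶜ f

/-- The conditional density `f(a | b)` of the variables in `A` given those in `B`. -/
noncomputable def condDensity (μ : ∀ i, Measure (Ω i)) (f : (∀ i, Ω i) → ℝ≥0∞)
    (A B : Finset V) : (∀ i, Ω i) → ℝ≥0∞ :=
  fun w => marginalDensity μ f (A ∪ B) w / marginalDensity μ f B w

/-- Conditional independence of `A` and `B` given `C` under the joint density `f`: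
`f(a, b, c) f(c) = f(a, c) f(b, c)` almost everywhere. -/
def CondIndepDensity (μ : ∀ i, Measure (Ω i)) (f : (∀ i, Ω i) → ℝ≥0∞)
    (A B C : Finset V) : Prop :=
  ∀ᵐ w ∂Measure.pi μ,
    marginalDensity μ f (A ∪ B ∪ C) w * marginalDensity μ f C w =
      marginalDensity μ f (A ∪ C) w * marginalDensity μ f (B ∪ C) w

/-- `F` is a set of interventional densities with a positive observational density `F ∅`.
For a set `S` of intervened variables, `F S w` is the value at `w` of the density
`f(· | do(S = (w i)_{i ∈ S}))`. The intervened coordinates are held at their prescribed values,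
and the density is one in the remaining coordinates. -/
structure IsInterventionalFamily (μ : ∀ i, Measure (Ω i))
    (F : Finset V → (∀ i, Ω i) → ℝ≥0∞) : Prop where
  measurable : ∀ S, Measurable (F S)
  lintegral_eq_one : ∫⁻ w, F ∅ w ∂Measure.pi μ = 1
  normalized : ∀ S, ∀ᵐ w ∂Measure.pi μ, lmarginal μ Sᶜ (F S) w = 1
  pos : ∀ᵐ w ∂Measure.pi μ, 0 < F ∅ w

/-- `D` is a causal Bayesian network compatible with `F`: every interventional density obeys the
truncated factorization. -/
def DAG.IsCompatible (D : DAG V) (μ : ∀ i, Measure (Ω i))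
    (F : Finset V → (∀ i, Ω i) → ℝ≥0∞) : Prop :=
  ∀ S, ∀ᵐ w ∂Measure.pi μ, F S w = ∏ i ∈ Sᶜ, condDensity μ (F ∅) {i} (D.parents i) w

/-- The density `f` is faithful to `D`. -/
def DAG.IsFaithful (D : DAG V) (μ : ∀ i, Measure (Ω i)) (f : (∀ i, Ω i) → ℝ≥0∞) : Prop :=
  ∀ A B C : Finset V, Disjoint A B → Disjoint A C → Disjoint B C →
    CondIndepDensity μ f A B C → D.DSep A B C

/-- `f(y | do(x)) = ∫ f(y | x, z) f(z) dz` for the interventional densities `F`. -/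
def AdjustmentFormula (μ : ∀ i, Measure (Ω i)) (F : Finset V → (∀ i, Ω i) → ℝ≥0∞)
    (X Y Z : Finset V) : Prop :=
  ∀ᵐ w ∂Measure.pi μ,
    lmarginal μ (X ∪ Y)ᶜ (F X) w =
      lmarginal μ Z
        (fun w' => condDensity μ (F ∅) Y (X ∪ Z) w' * marginalDensity μ (F ∅) Z w') w

end Densities

/-- `Z` is an adjustment set relative to `(X, Y)` in the causal DAG `D`: the adjustment formula
holds for all interventional densities consistent with `D`, whatever the value spaces of the
variables and the reference measures. -/
def IsAdjustmentSet {V : Type v} [Fintype V] [DecidableEq V] (D : DAG V)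
    (X Y Z : Finset V) : Prop :=
  Disjoint X Y ∧ Disjoint X Z ∧ Disjoint Y Z ∧
    ∀ (Ω : V → Type u) [∀ i, MeasurableSpace (Ω i)] (μ : ∀ i, Measure (Ω i))
      [∀ i, SigmaFinite (μ i)] (F : Finset V → (∀ i, Ω i) → ℝ≥0∞),
      IsInterventionalFamily μ F → D.IsCompatible μ F → AdjustmentFormula μ F X Y Z

/-- `Z` is an adjustment set and no proper subset of `Z` is one. -/
def IsMinimalAdjustmentSet {V : Type v} [Fintype V] [DecidableEq V] (D : DAG V)
    (X Y Z : Finset V) : Prop :=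
  IsAdjustmentSet.{v, u} D X Y Z ∧ ∀ Z' ⊂ Z, ¬ IsAdjustmentSet.{v, u} D X Y Z'

/-- A structural equation model with variables `V`: each variable is a function of its causal
determinants (its parents in `D`) and of a random noise. The joint law of the noises is
arbitrary. -/
structure StructuralModel (V : Type v) [Fintype V] (Ω : V → Type u)
    [∀ i, MeasurableSpace (Ω i)] where
  /-- the induced graph -/
  D : DAG V
  /-- the noise spaces -/
  E : V → Type u
  [measurableSpaceE : ∀ i, MeasurableSpace (E i)]
  /-- the joint law of the noises -/
  noise : Measure (∀ i, E i)
  [isProbabilityMeasure_noise : IsProbabilityMeasure noise]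
  /-- the structural equations -/
  eqn : ∀ i, (∀ j : {j // D.Adj j i}, Ω j) × E i → Ω i
  measurable_eqn : ∀ i, Measurable (eqn i)

attribute [instance] StructuralModel.measurableSpaceE
attribute [instance] StructuralModel.isProbabilityMeasure_noise

namespace StructuralModel

variable {V : Type v} [Fintype V] [DecidableEq V] {Ω : V → Type u}
  [∀ i, MeasurableSpace (Ω i)] (M : StructuralModel V Ω)

/-- The solution of the equations for the noise values `e`, under the intervention that sets
the variables in `S` to their values in `x`. -/
noncomputable def solve (S : Finset V) (x : ∀ i, Ω i) (e : ∀ i, M.E i) : ∀ i, Ω i :=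
  M.D.wellFounded_adj.fix
    (fun i ih => if i ∈ S then x i else M.eqn i (fun j => ih j.1 j.2, e i))

theorem solve_eq (S : Finset V) (x : ∀ i, Ω i) (e : ∀ i, M.E i) (i : V) :
    M.solve S x e i =
      if i ∈ S then x i else M.eqn i (fun j => M.solve S x e j.1, e i) := by
  unfold solve
  rw [WellFounded.fix_eq]

theorem measurable_solve (S : Finset V) (x : ∀ i, Ω i) : Measurable (M.solve S x) := by
  refine measurable_pi_iff.2 fun i => ?_
  induction i using M.D.wellFounded_adj.induction with
  | _ i ih =>
    simp only [solve_eq M S x _ i]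
    split_ifs
    · exact measurable_const
    · exact (M.measurable_eqn i).comp
        ((measurable_pi_iff.2 fun j => ih j.1 j.2).prodMk (measurable_pi_apply i))

/-- The distribution of the variables under the intervention `do(S = (x i)_{i ∈ S})`. -/
noncomputable def law (S : Finset V) (x : ∀ i, Ω i) : Measure (∀ i, Ω i) :=
  M.noise.map (M.solve S x)

/-- `F` consists of the interventional densities of the model: under `do(S = (x i)_{i ∈ S})`,
the variables in `S` are fixed and the others have the density `F S`. -/
structure Induces (μ : ∀ i, Measure (Ω i)) (F : Finset V → (∀ i, Ω i) → ℝ≥0∞) : Prop where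
  isInterventionalFamily : IsInterventionalFamily μ F
  law_apply : ∀ S, ∀ᵐ x ∂Measure.pi μ, ∀ A, MeasurableSet A →
    M.law S x A = lmarginal μ Sᶜ (A.indicator (F S)) x

/-- The standing properties of a causal model: it induces the interventional densities `F`, these
are consistent with its DAG, and the observational density `F ∅` is faithful to the DAG. -/
structure IsCausalModel (μ : ∀ i, Measure (Ω i)) (F : Finset V → (∀ i, Ω i) → ℝ≥0∞) :
    Prop where
  induces : M.Induces μ F
  compatible : M.D.IsCompatible μ F
  faithful : M.D.IsFaithful μ (F ∅)

end StructuralModel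

/-!
Write `D_X` for the DAG `D` without the edges that leave `X`. An adjustment set `Z` separates `X`
from `Y` in the moral graph of the ancestors of `X`, `Y` and `Z` in `D_X`. If it did not, some
unobserved node would emit a random bit that reaches `Y` and is linked to a bit visible to `X` by
a chain of comparisons that the elements of `Z` make public. In the resulting model `X` has no
effect, but adjusting for `Z` makes the bit at `Y` depend on the value of `X`. The model has zero
probabilities, and it is approximated by positive ones.

Sufficiency of the two dependences is then a statement about separators in an undirected graph. By
the global Markov property each dependence gives a connection in a moral graph of `D`. As `X` is
not an ancestor of `T`, these connections persist in `D_X`, so that each `t ∈ T` is joined to `X`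
and to `Y` by connections that avoid the rest of `T`. No proper subset of `T` can therefore
separate `X` from `Y`.

Conversely, an independence that allows `T` to be shrunk holds, by faithfulness and the global
Markov property, in all models that are consistent with `D`, and in each of them it turns the
adjustment formula for `T` into the formula for the smaller set.
-/

/-! ### Moral graphs of ancestral sets -/

section Moral

variable {V : Type v}

/-- The nodes from which some element of `S` can be reached along `R`: the ancestral set of `S`
when `R` is the adjacency relation of a directed graph. -/
def ancestralSet (R : V → V → Prop) (S : Set V) : Set V :=
  {i | ∃ s ∈ S, Relation.ReflTransGen R i s}

/-- Adjacency in the moral graph of the restriction of `R` to `W`, with the nodes in `C` removed: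
`i` and `j` are joined by an edge or have a common child. The common child lies in `W`, but it may
be one of the removed nodes. -/
def MoralAdj (R : V → V → Prop) (W C : Set V) (i j : V) : Prop :=
  (i ∈ W ∧ i ∉ C) ∧ (j ∈ W ∧ j ∉ C) ∧ (R i j ∨ R j i ∨ ∃ s ∈ W, R i s ∧ R j s)

/-- Connection in the moral graph of the restriction of `R` to `W`, with the nodes in `C`
removed. Every node counts as connected to itself, even if it is not in `W` or is removed. -/
def MoralConn (R : V → V → Prop) (W C : Set V) : V → V → Prop :=
  Relation.ReflTransGen (MoralAdj R W C)

variable {R : V → V → Prop} {W W' C C' S S' : Set V} {i j x y t : V}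

theorem subset_ancestralSet (R : V → V → Prop) (S : Set V) : S ⊆ ancestralSet R S :=
  fun s hs => ⟨s, hs, .refl⟩

theorem mem_ancestralSet_of_reflTransGen (h : Relation.ReflTransGen R i j)
    (hj : j ∈ ancestralSet R S) : i ∈ ancestralSet R S :=
  let ⟨s, hs, hr⟩ := hj
  ⟨s, hs, h.trans hr⟩

theorem mem_ancestralSet_of_rel (h : R i j) (hj : j ∈ ancestralSet R S) : i ∈ ancestralSet R S :=
  mem_ancestralSet_of_reflTransGen (.single h) hj

theorem ancestralSet_subset (h : S ⊆ ancestralSet R S') : ancestralSet R S ⊆ ancestralSet R S' :=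
  fun _ ⟨_, hs, hr⟩ => mem_ancestralSet_of_reflTransGen hr (h hs)

theorem ancestralSet_mono (h : S ⊆ S') : ancestralSet R S ⊆ ancestralSet R S' :=
  ancestralSet_subset (h.trans (subset_ancestralSet R S'))

theorem MoralAdj.symm (h : MoralAdj R W C i j) : MoralAdj R W C j i := by
  obtain ⟨hi, hj, h | h | ⟨s, hs, his, hjs⟩⟩ := h
  exacts [⟨hj, hi, .inr (.inl h)⟩, ⟨hj, hi, .inl h⟩, ⟨hj, hi, .inr (.inr ⟨s, hs, hjs, his⟩)⟩]

theorem MoralAdj.mono (hW : W ⊆ W') (hC : C' ⊆ C) (h : MoralAdj R W C i j) :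
    MoralAdj R W' C' i j :=
  ⟨⟨hW h.1.1, fun hi => h.1.2 (hC hi)⟩, ⟨hW h.2.1.1, fun hj => h.2.1.2 (hC hj)⟩,
    h.2.2.imp_right (Or.imp_right fun ⟨s, hs, his⟩ => ⟨s, hW hs, his⟩)⟩

theorem MoralConn.symm (h : MoralConn R W C i j) : MoralConn R W C j i :=
  have : Std.Symm (MoralAdj R W C) := ⟨fun _ _ h => h.symm⟩
  (Relation.ReflTransGen.stdSymm (r := MoralAdj R W C)).symm _ _ h

theorem MoralConn.mono (hW : W ⊆ W') (hC : C' ⊆ C) (h : MoralConn R W C i j) :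
    MoralConn R W' C' i j :=
  Relation.ReflTransGen.mono (fun _ _ => MoralAdj.mono hW hC) _ _ h

theorem wellFounded_swap_transGen [Finite V] (hR : ∀ i, ¬ Relation.TransGen R i i) :
    WellFounded (Function.swap (Relation.TransGen R)) :=
  have : Std.Irrefl (Function.swap (Relation.TransGen R)) := ⟨hR⟩
  have : IsTrans V (Function.swap (Relation.TransGen R)) := ⟨fun _ _ _ h h' => h'.trans h⟩
  Finite.wellFounded_of_trans_of_irrefl _

/-! ### Minimal separators of the moral graph -/

variable {T Z : Set V}

theorem MoralConn.exists_last (hx : x ∉ T) (ht : t ∈ T) (h : MoralConn R W (T \ {t}) x t) :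
    ∃ i, MoralConn R W T x i ∧ MoralAdj R W (T \ {t}) i t := by
  have key : ∀ y, MoralConn R W (T \ {t}) x y → (MoralConn R W T x y ∧ y ∉ T) ∨
      ∃ i, MoralConn R W T x i ∧ MoralAdj R W (T \ {t}) i t := by
    intro y hy
    induction hy with
    | refl => exact .inl ⟨.refl, hx⟩
    | @tail y z _ hyz ih =>
      obtain ⟨ih, hyT⟩ | ih := ih
      · obtain rfl | hz := eq_or_ne z t
        · exact .inr ⟨y, ih, hyz⟩
        · have hzT : z ∉ T := fun h => hyz.2.1.2 ⟨h, hz⟩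
          exact .inl ⟨.tail ih ⟨⟨hyz.1.1, hyT⟩, ⟨hyz.2.1.1, hzT⟩, hyz.2.2⟩, hzT⟩
      · exact .inr ih
  exact (key t h).resolve_left fun h => h.2 ht

-- The last steps towards `t` must be edges into `t`, so that `t` is a common child.
theorem MoralConn.of_sink (hx : x ∉ T) (hy : y ∉ T) (ht : t ∈ T) (hsink : ∀ s ∈ W, ¬ R t s)
    (hxt : MoralConn R W (T \ {t}) x t) (hyt : MoralConn R W (T \ {t}) y t) :
    MoralConn R W T x y := by
  have hlast : ∀ i, MoralAdj R W (T \ {t}) i t → i ∉ T ∧ R i t := by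
    rintro i ⟨hi, ⟨htW, -⟩, hit⟩
    have hit : R i t := by
      obtain h | h | ⟨s, hs, -, h⟩ := hit
      exacts [h, absurd h (hsink i hi.1), absurd h (hsink s hs)]
    refine ⟨fun hiT => hi.2 ⟨hiT, ?_⟩, hit⟩
    rintro rfl
    exact hsink i htW hit
  obtain ⟨i, hxi, hit⟩ := hxt.exists_last hx ht
  obtain ⟨j, hyj, hjt⟩ := hyt.exists_last hy ht
  obtain ⟨hiT, hi⟩ := hlast i hit
  obtain ⟨hjT, hj⟩ := hlast j hjt
  have hij : MoralAdj R W T i j :=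
    ⟨⟨hit.1.1, hiT⟩, ⟨hjt.1.1, hjT⟩, .inr (.inr ⟨t, hit.2.1.1, hi, hj⟩)⟩
  exact .trans (.tail hxi hij) hyj.symm

theorem exists_sink_of_not_subset_ancestralSet [Finite V] (hR : ∀ i, ¬ Relation.TransGen R i i)
    (hS : S ⊆ ancestralSet R S') (hT : ¬ T ⊆ ancestralSet R S') :
    ∃ t ∈ T, ∀ s ∈ ancestralSet R (S ∪ T), ¬ R t s := by
  obtain ⟨t, ⟨htT, ht⟩, hmax⟩ := (wellFounded_swap_transGen hR).has_min (T \ ancestralSet R S')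
    (Set.sdiff_nonempty.2 hT)
  refine ⟨t, htT, ?_⟩
  rintro s ⟨s', hs', hss'⟩ hts
  have hts' : Relation.TransGen R t s' := .head' hts hss'
  have hs'S' : s' ∉ ancestralSet R S' :=
    fun h => ht (mem_ancestralSet_of_reflTransGen hts'.to_reflTransGen h)
  exact hmax s' ⟨hs'.resolve_left fun h => hs'S' (hS h), hs'S'⟩ hts'

theorem MoralConn.of_ssubset [Finite V] (hR : ∀ i, ¬ Relation.TransGen R i i)
    (hx : x ∉ T) (hy : y ∉ T) (hZ : Z ⊂ T)
    (hxT : ∀ t ∈ T, MoralConn R (ancestralSet R ({x, y} ∪ T)) (T \ {t}) x t)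
    (hyT : ∀ t ∈ T, MoralConn R (ancestralSet R ({x, y} ∪ T)) (T \ {t}) y t)
    (hsep : ¬ MoralConn R (ancestralSet R ({x, y} ∪ T)) T x y) :
    MoralConn R (ancestralSet R ({x, y} ∪ Z)) Z x y := by
  have hxy : {x, y} ⊆ ancestralSet R ({x, y} ∪ Z) :=
    Set.subset_union_left.trans (subset_ancestralSet R _)
  by_cases hTW : T ⊆ ancestralSet R ({x, y} ∪ Z)
  · have hW : ancestralSet R ({x, y} ∪ T) ⊆ ancestralSet R ({x, y} ∪ Z) :=
      ancestralSet_subset (Set.union_subset hxy hTW)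
    obtain ⟨t, ht, htZ⟩ := Set.exists_of_ssubset hZ
    have hC : Z ⊆ T \ {t} := Set.subset_sdiff_singleton hZ.subset htZ
    exact ((hxT t ht).mono hW hC).trans ((hyT t ht).mono hW hC).symm
  · obtain ⟨t, ht, hsink⟩ := exists_sink_of_not_subset_ancestralSet hR hxy hTW
    exact absurd (of_sink hx hy ht hsink (hxT t ht) (hyT t ht)) hsep

end Moral

/-! ### Open walks -/

theorem infix_append_cons_cases {α : Type*} {a b c x : α} {l₁ l₂ : List α}
    (h : [a, b, c] <:+: l₁ ++ x :: l₂) :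
    [a, b, c] <:+: l₁ ++ [x] ∨ [a, b, c] <:+: x :: l₂ ∨
      (b = x ∧ l₁.getLast? = some a ∧ l₂.head? = some c) := by
  induction l₁ with
  | nil => exact .inr (.inl h)
  | cons y l ih =>
    rw [List.cons_append, List.infix_cons_iff] at h
    obtain h | h := h
    · match l, l₂ with
      | [], [] => simp at h
      | [], d :: l₂ => simp_all
      | [z], l₂ => exact .inl (by simp_all)
      | z :: z' :: l, l₂ =>
        simp only [List.cons_append, List.cons_prefix_cons] at h
        obtain ⟨rfl, rfl, rfl, -⟩ := h
        exact .inl ⟨[], l ++ [x], by simp⟩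
    · obtain h | h | ⟨hb, h₁, h₂⟩ := ih h
      · exact .inl (h.trans (List.suffix_cons y _).isInfix)
      · exact .inr (.inl h)
      · exact .inr (.inr ⟨hb, List.mem_getLast?_cons h₁, h₂⟩)

theorem exists_eq_append_of_not_nodup {α : Type*} {p : List α} (h : ¬ p.Nodup) :
    ∃ l₁ x l₂ l₃, p = l₁ ++ x :: l₂ ++ x :: l₃ := by
  obtain ⟨x, hx⟩ := List.exists_duplicate_iff_not_nodup.2 h
  obtain ⟨r₁, r₂, rfl, h₁, h₂⟩ := List.cons_sublist_iff.1 (List.duplicate_iff_sublist.1 hx)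
  obtain ⟨l₁, l₂, rfl⟩ := List.append_of_mem h₁
  obtain ⟨l₂', l₃, rfl⟩ := List.append_of_mem (List.singleton_sublist.1 h₂)
  exact ⟨l₁, x, l₂ ++ l₂', l₃, by simp⟩

namespace DAG

variable {V : Type v} (D : DAG V)

/-- A walk: a sequence of nodes, possibly with repetitions, successive ones joined by an edge in
either direction. -/
def IsWalk (p : List V) : Prop := p.IsChain (fun i j => D.Adj i j ∨ D.Adj j i)

/-- Some walk from the node set `A` to the node set `B` is open given `C`. This is the analogue of
`¬ D.DSep A B C` for walks in place of paths. -/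
def HasOpenWalk (A B C : Finset V) : Prop :=
  ∃ a ∈ A, ∃ l, D.IsWalk (a :: l) ∧ D.IsOpen (a :: l) C ∧ ∃ b ∈ B, (a :: l).getLast? = some b

/-- There is an open walk from `x` to `B` given `C` that stays open when it is continued beyond `x`
by an edge into `x` and, if `x ∉ C`, also when it is continued by an edge out of `x`. It is the
invariant that is propagated along connections in the moral graph. -/
def OpenReach (B C : Finset V) (x : V) : Prop :=
  ∃ l, D.IsWalk (x :: l) ∧ D.IsOpen (x :: l) C ∧ (∃ b ∈ B, (x :: l).getLast? = some b) ∧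
    (l = [] ∨ ∃ w l', l = w :: l' ∧
      (D.Adj x w ∧ x ∉ C ∨ D.Adj w x ∧ ∃ c ∈ C, D.IsAncestor x c))

variable {D} {A B C : Finset V} {a b x y u w : V} {p q l l₁ l₂ l₃ : List V}

theorem not_adj_of_adj (h : D.Adj x y) : ¬ D.Adj y x :=
  fun h' => D.acyclic x (.tail (.single h) h')

theorem isOpen_of_length_le (hp : p.length ≤ 2) : D.IsOpen p C :=
  ⟨fun _ ⟨_, _, hi, _⟩ => absurd (hi.length_le.trans hp) (by simp),
    fun _ ⟨_, _, hi, _⟩ => absurd (hi.length_le.trans hp) (by simp)⟩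

theorem IsOpen.of_infix (h : D.IsOpen p C) (hq : q <:+: p) : D.IsOpen q C :=
  ⟨fun b ⟨a, c, hi, hb⟩ => h.1 b ⟨a, c, hi.trans hq, hb⟩,
    fun b ⟨a, c, hi, hb⟩ => h.2 b ⟨a, c, hi.trans hq, hb⟩⟩

theorem IsOpen.append_cons (h₁ : D.IsOpen (l₁ ++ [x]) C) (h₂ : D.IsOpen (x :: l₂) C)
    (hx : ∀ a c, l₁.getLast? = some a → l₂.head? = some c →
      (D.Adj x a ∨ D.Adj x c → x ∉ C) ∧
        (D.Adj a x → D.Adj c x → ∃ d ∈ C, D.IsAncestor x d)) :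
    D.IsOpen (l₁ ++ x :: l₂) C := by
  constructor
  · rintro b ⟨a, c, hi, hb⟩
    obtain hi | hi | ⟨rfl, ha, hc⟩ := infix_append_cons_cases hi
    exacts [h₁.1 b ⟨a, c, hi, hb⟩, h₂.1 b ⟨a, c, hi, hb⟩, (hx a c ha hc).1 hb]
  · rintro b ⟨a, c, hi, hab, hcb⟩
    obtain hi | hi | ⟨rfl, ha, hc⟩ := infix_append_cons_cases hi
    exacts [h₁.2 b ⟨a, c, hi, hab, hcb⟩, h₂.2 b ⟨a, c, hi, hab, hcb⟩, (hx a c ha hc).2 hab hcb]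

theorem IsOpen.cons (h : D.IsOpen (u :: w :: l) C) (h₁ : D.Adj u x ∨ D.Adj u w → u ∉ C)
    (h₂ : D.Adj x u → D.Adj w u → ∃ c ∈ C, D.IsAncestor u c) : D.IsOpen (x :: u :: w :: l) C := by
  refine IsOpen.append_cons (l₁ := [x]) (isOpen_of_length_le (by simp)) h ?_
  rintro a c ⟨⟩ ⟨⟩
  exact ⟨h₁, h₂⟩

theorem IsOpen.ancestor_or_transGen (hw : D.IsWalk (x :: w :: l)) (ho : D.IsOpen (x :: w :: l) C)
    (hx : D.Adj x w) (hy : (x :: w :: l).getLast? = some y) :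
    (∃ c ∈ C, D.IsAncestor x c) ∨ Relation.TransGen D.Adj x y := by
  induction l generalizing x w with
  | nil =>
    obtain rfl : w = y := by simpa using hy
    exact .inr (.single hx)
  | cons d l ih =>
    obtain hd | hd : D.Adj w d ∨ D.Adj d w := (List.isChain_cons_cons.1 hw.tail).1
    · obtain ⟨c, hc, h⟩ | h :=
        ih hw.tail (ho.of_infix (List.suffix_cons x _).isInfix) hd (by simpa using hy)
      · exact .inl ⟨c, hc, .head hx h⟩
      · exact .inr (.head hx h)
    · obtain ⟨c, hc, h⟩ := ho.2 w ⟨x, d, ⟨[], l, by simp⟩, hx, hd⟩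
      exact .inl ⟨c, hc, .head hx h⟩

-- If the merged visit is a collider although the first one was not, then the loop leaves `x` along
-- an edge out of `x`; by acyclicity it meets a collider, so that `x` is an ancestor of `C`.
theorem IsOpen.cut (hw : D.IsWalk (l₁ ++ x :: l₂ ++ x :: l₃))
    (ho : D.IsOpen (l₁ ++ x :: l₂ ++ x :: l₃) C) : D.IsOpen (l₁ ++ x :: l₃) C := by
  obtain ⟨d, m, hm⟩ := List.exists_cons_of_ne_nil (l := l₂ ++ [x]) (by simp)
  obtain ⟨n, e, hn⟩ := List.eq_nil_or_concat' (x :: l₂) |>.resolve_left (by simp)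
  have hloop : x :: d :: m <:+: l₁ ++ x :: l₂ ++ x :: l₃ := ⟨l₁, l₃, by simp [← hm]⟩
  have hlast : (x :: d :: m).getLast? = some x := by
    rw [← hm, ← List.cons_append, List.getLast?_concat]
  refine IsOpen.append_cons (ho.of_infix ⟨[], l₂ ++ x :: l₃, by simp⟩)
    (ho.of_infix ⟨l₁ ++ x :: l₂, [], by simp⟩) fun a c ha hc => ?_
  have hfirst : [a, x, d] <:+: l₁ ++ x :: l₂ ++ x :: l₃ := by
    obtain ⟨l, rfl⟩ := List.getLast?_eq_some_iff.1 ha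
    have : l₂ ++ x :: l₃ = d :: m ++ l₃ := by simp [← hm]
    exact ⟨l, m ++ l₃, by simp [this]⟩
  have hsecond : [e, x, c] <:+: l₁ ++ x :: l₂ ++ x :: l₃ := by
    obtain ⟨l, rfl⟩ := List.head?_eq_some_iff.1 hc
    exact ⟨l₁ ++ n, l, by rw [List.append_assoc l₁ (x :: l₂), hn]; simp⟩
  refine ⟨?_, fun hax _ => ?_⟩
  · rintro (h | h)
    exacts [ho.1 x ⟨a, d, hfirst, .inl h⟩, ho.1 x ⟨e, c, hsecond, .inr h⟩]
  · have hwloop : D.IsWalk (x :: d :: m) := List.IsChain.infix hw hloop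
    obtain hxd | hdx : D.Adj x d ∨ D.Adj d x := (List.isChain_cons_cons.1 hwloop).1
    · exact ((ho.of_infix hloop).ancestor_or_transGen hwloop hxd hlast).resolve_right (D.acyclic x)
    · exact ho.2 x ⟨a, d, hfirst, hax, hdx⟩

theorem IsWalk.cut (hw : D.IsWalk (l₁ ++ x :: l₂ ++ x :: l₃)) : D.IsWalk (l₁ ++ x :: l₃) :=
  List.isChain_split.2 ⟨List.IsChain.infix hw ⟨[], l₂ ++ x :: l₃, by simp⟩,
    List.IsChain.infix hw ⟨l₁ ++ x :: l₂, [], by simp⟩⟩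

theorem IsOpen.exists_isPath (hp : p ≠ []) (hw : D.IsWalk p) (ho : D.IsOpen p C) :
    ∃ q, D.IsPath q ∧ D.IsOpen q C ∧ q.head? = p.head? ∧ q.getLast? = p.getLast? := by
  induction hn : p.length using Nat.strong_induction_on generalizing p with
  | _ n ih =>
    by_cases hd : p.Nodup
    · exact ⟨p, ⟨hp, hd, hw⟩, ho, rfl, rfl⟩
    · obtain ⟨l₁, x, l₂, l₃, rfl⟩ := exists_eq_append_of_not_nodup hd
      have hlt : (l₁ ++ x :: l₃).length < n := by
        simp only [List.length_append, List.length_cons] at hn ⊢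
        omega
      obtain ⟨q, hq, hqo, hhead, hlast⟩ := ih _ hlt (by simp) hw.cut (ho.cut hw) rfl
      exact ⟨q, hq, hqo, hhead.trans (by cases l₁ <;> simp),
        hlast.trans (by simp [List.getLast?_cons])⟩

theorem DSep.not_hasOpenWalk (h : D.DSep A B C) : ¬ D.HasOpenWalk A B C := by
  rintro ⟨a, ha, l, hw, ho, b, hb, hl⟩
  obtain ⟨q, hq, hqo, hhead, hlast⟩ := ho.exists_isPath (by simp) hw
  exact h q ⟨hq, ⟨a, ha, hhead⟩, b, hb, hlast.trans hl⟩ hqo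

theorem openReach_of_mem (hb : b ∈ B) : D.OpenReach B C b :=
  ⟨[], by simp [IsWalk], isOpen_of_length_le (by simp), ⟨b, hb, rfl⟩, .inl rfl⟩

theorem OpenReach.of_child (h : D.OpenReach B C x) (hyx : D.Adj y x) (hy : y ∉ C) :
    D.OpenReach B C y := by
  obtain ⟨l, hw, ho, ⟨b, hb, hl⟩, hd⟩ := h
  refine ⟨x :: l, List.isChain_cons_cons.2 ⟨.inl hyx, hw⟩, ?_, ⟨b, hb, by simpa using hl⟩,
    .inr ⟨x, l, rfl, .inl ⟨hyx, hy⟩⟩⟩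
  obtain rfl | ⟨w, l', rfl, ⟨hxw, hx⟩ | ⟨hwx, hx⟩⟩ := hd
  · exact isOpen_of_length_le (by simp)
  · exact ho.cons (fun _ => hx) (fun _ h => absurd h (not_adj_of_adj hxw))
  · exact ho.cons (fun h => (h.elim (not_adj_of_adj hyx) (not_adj_of_adj hwx)).elim) (fun _ _ => hx)

theorem openReach_of_isAncestor (hb : b ∈ B) (h : D.IsAncestor x b)
    (hx : ¬ ∃ c ∈ C, D.IsAncestor x c) : D.OpenReach B C x := by
  induction h using Relation.ReflTransGen.head_induction_on with
  | refl => exact openReach_of_mem hb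
  | @head x y hxy _ ih =>
    exact (ih fun ⟨c, hc, h⟩ => hx ⟨c, hc, .head hxy h⟩).of_child hxy
      fun hc => hx ⟨x, hc, .refl⟩

theorem exists_openWalk_of_isAncestor (hw : D.IsWalk (x :: w :: l))
    (ho : D.IsOpen (x :: w :: l) C) (h : D.IsAncestor x a) (hx : ¬ ∃ c ∈ C, D.IsAncestor x c) :
    ∃ l', D.IsWalk (a :: l') ∧ D.IsOpen (a :: l') C ∧
      (a :: l').getLast? = (x :: w :: l).getLast? := by
  induction h using Relation.ReflTransGen.head_induction_on generalizing w l with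
  | refl => exact ⟨_, hw, ho, rfl⟩
  | @head x y hxy _ ih =>
    have hy : ¬ ∃ c ∈ C, D.IsAncestor y c := fun ⟨c, hc, h⟩ => hx ⟨c, hc, .head hxy h⟩
    have hxC : x ∉ C := fun hc => hx ⟨x, hc, .refl⟩
    obtain ⟨l', hw', ho', hl'⟩ := ih (List.isChain_cons_cons.2 ⟨.inr hxy, hw⟩)
      (ho.cons (fun _ => hxC) (fun h => absurd h (not_adj_of_adj hxy))) hy
    exact ⟨l', hw', ho', by simpa using hl'⟩

theorem OpenReach.of_parent (hAB : ¬ D.HasOpenWalk A B C) (h : D.OpenReach B C x)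
    (hxy : D.Adj x y) (hx : x ∉ C) (hy : y ∈ ancestralSet D.Adj (A ∪ B ∪ C : Set V)) :
    D.OpenReach B C y := by
  obtain ⟨l, hw, ho, ⟨b, hb, hl⟩, hd⟩ := h
  have hw' : D.IsWalk (y :: x :: l) := List.isChain_cons_cons.2 ⟨.inr hxy, hw⟩
  have ho' : D.IsOpen (y :: x :: l) C := by
    obtain rfl | ⟨w, l', rfl, -⟩ := hd
    · exact isOpen_of_length_le (by simp)
    · exact ho.cons (fun _ => hx) (fun h => absurd h (not_adj_of_adj hxy))
  have hl' : (y :: x :: l).getLast? = some b := by simpa using hl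
  by_cases hyC : ∃ c ∈ C, D.IsAncestor y c
  · exact ⟨x :: l, hw', ho', ⟨b, hb, hl'⟩, .inr ⟨x, l, rfl, .inr ⟨hxy, hyC⟩⟩⟩
  obtain ⟨s, (hs | hs) | hs, hys⟩ := hy
  · obtain ⟨l'', hw'', ho'', hl''⟩ := exists_openWalk_of_isAncestor hw' ho' hys hyC
    exact absurd ⟨s, hs, l'', hw'', ho'', b, hb, hl''.trans hl'⟩ hAB
  · exact openReach_of_isAncestor hs hys hyC
  · exact absurd ⟨s, hs, hys⟩ hyC

theorem OpenReach.of_moralConn (hAB : ¬ D.HasOpenWalk A B C) (hb : b ∈ B)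
    (h : MoralConn D.Adj (ancestralSet D.Adj (A ∪ B ∪ C : Set V)) C b a) : D.OpenReach B C a := by
  induction h with
  | refl => exact openReach_of_mem hb
  | tail _ hxy ih =>
    obtain ⟨⟨-, hx⟩, ⟨hyW, hy⟩, hxy | hyx | ⟨s, hs, hxs, hys⟩⟩ := hxy
    · exact ih.of_parent hAB hxy hx hyW
    · exact ih.of_child hyx hy
    · exact (ih.of_parent hAB hxs hx hs).of_child hys hy

theorem DSep.not_moralConn (h : D.DSep A B C) (ha : a ∈ A) (hb : b ∈ B) :
    ¬ MoralConn D.Adj (ancestralSet D.Adj (A ∪ B ∪ C : Set V)) C a b := by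
  intro hab
  obtain ⟨l, hw, ho, hl, -⟩ := OpenReach.of_moralConn h.not_hasOpenWalk hb hab.symm
  exact h.not_hasOpenWalk ⟨a, ha, l, hw, ho, hl⟩

end DAG

/-! ### The graph without the edges out of the treatment -/

namespace DAG

variable {V : Type v} (D : DAG V)

/-- The edges of `D` that do not start at `x`. Connections between `x` and another node along these
edges are the back-door connections of `x`. -/
def BackdoorAdj (x i j : V) : Prop := D.Adj i j ∧ i ≠ x

variable {D} {x y i j : V} {S T W C Z N : Set V}

theorem BackdoorAdj.acyclic (x i : V) : ¬ Relation.TransGen (D.BackdoorAdj x) i i :=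
  fun h => D.acyclic i (Relation.TransGen.mono (fun _ _ h => h.1) _ _ h)

theorem ancestralSet_backdoorAdj (hx : x ∈ S) :
    ancestralSet (D.BackdoorAdj x) S = ancestralSet D.Adj S := by
  refine Set.Subset.antisymm (fun i ⟨s, hs, h⟩ =>
    ⟨s, hs, Relation.ReflTransGen.mono (fun _ _ h => h.1) _ _ h⟩) ?_
  rintro i ⟨s, hs, h⟩
  induction h using Relation.ReflTransGen.head_induction_on with
  | refl => exact subset_ancestralSet _ _ hs
  | @head i j hij _ ih =>
    obtain rfl | hi := eq_or_ne i x
    · exact subset_ancestralSet _ _ hx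
    · exact mem_ancestralSet_of_rel ⟨hij, hi⟩ ih

theorem moralConn_backdoorAdj (hx : ∀ i ∉ C, ∀ s ∈ W, D.Adj i s → i ≠ x)
    (h : MoralConn D.Adj W C i j) : MoralConn (D.BackdoorAdj x) W C i j := by
  refine Relation.ReflTransGen.mono (fun i j hij => ?_) _ _ h
  obtain ⟨hi, hj, h | h | ⟨s, hs, his, hjs⟩⟩ := hij
  · exact ⟨hi, hj, .inl ⟨h, hx i hi.2 j hj.1 h⟩⟩
  · exact ⟨hi, hj, .inr (.inl ⟨h, hx j hj.2 i hi.1 h⟩)⟩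
  · exact ⟨hi, hj, .inr (.inr ⟨s, hs, ⟨his, hx i hi.2 s hs his⟩, ⟨hjs, hx j hj.2 s hs hjs⟩⟩)⟩

theorem moralConn_backdoorAdj_of_mem (hxS : x ∈ S) (hxC : x ∈ C)
    (h : MoralConn D.Adj (ancestralSet D.Adj S) C i j) :
    MoralConn (D.BackdoorAdj x) (ancestralSet (D.BackdoorAdj x) S) C i j := by
  rw [ancestralSet_backdoorAdj hxS]
  exact moralConn_backdoorAdj (fun i hi _ _ _ hix => hi (hix ▸ hxC)) h

theorem moralConn_backdoorAdj_of_not_isAncestor (hT : ∀ t ∈ T, ¬ D.IsAncestor x t)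
    (h : MoralConn D.Adj (ancestralSet D.Adj ({x} ∪ T)) C i j) :
    MoralConn (D.BackdoorAdj x) (ancestralSet (D.BackdoorAdj x) ({x} ∪ T)) C i j := by
  rw [ancestralSet_backdoorAdj (Set.mem_union_left T (Set.mem_singleton x))]
  refine moralConn_backdoorAdj ?_ h
  rintro i - s ⟨t, rfl | ht, hst⟩ his rfl
  · exact D.acyclic i (.head' his hst)
  · exact hT t ht (.head his hst)

/-! ### Signals through unobserved nodes -/

variable (D)

/-- There is a directed path from `r` to `i` whose nodes after `r` are not in the set `N` of
observed nodes: `i` receives the signal emitted by `r`. -/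
def Carries (N : Set V) (r i : V) : Prop :=
  Relation.ReflTransGen (fun i j => D.Adj i j ∧ j ∉ N) r i

/-- Some parent of `s` carries the signal emitted by `r`. Here `s` itself may be observed. -/
def Visible (N : Set V) (s r : V) : Prop := ∃ p, D.Adj p s ∧ D.Carries N r p

/-- The signals emitted by the unobserved nodes `r` and `r'` are both visible to one element of
`Z`. -/
def Linked (N Z : Set V) (r r' : V) : Prop :=
  r ∉ N ∧ r' ∉ N ∧ ∃ z ∈ Z, D.Visible N z r ∧ D.Visible N z r'

/-- A chain of links joins `i` to a node whose signal is visible to `x`. -/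
def LinkedTo (N Z : Set V) (x i : V) : Prop :=
  ∃ r, r ∉ N ∧ D.Visible N x r ∧ Relation.ReflTransGen (D.Linked N Z) r i

variable {D}

theorem Visible.of_adj (h : D.Adj i j) : D.Visible N j i := ⟨i, h, .refl⟩

theorem Visible.head (h : D.Visible N x j) (hij : D.Adj i j) (hj : j ∉ N) : D.Visible N x i :=
  let ⟨p, hp, hjp⟩ := h
  ⟨p, hp, .head ⟨hij, hj⟩ hjp⟩

theorem LinkedTo.of_visible (hi : i ∉ N) (h : D.Visible N x i) : D.LinkedTo N Z x i :=
  ⟨i, hi, h, .refl⟩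

theorem LinkedTo.tail (h : D.LinkedTo N Z x i) (hij : D.Linked N Z i j) : D.LinkedTo N Z x j :=
  let ⟨r, hr, hv, hri⟩ := h
  ⟨r, hr, hv, hri.tail hij⟩

theorem LinkedTo.notMem (h : D.LinkedTo N Z x i) : i ∉ N := by
  obtain ⟨r, hr, -, h⟩ := h
  cases h with
  | refl => exact hr
  | tail _ h => exact h.2.1

theorem LinkedTo.of_adj (h : D.LinkedTo N Z x j) (hij : D.Adj i j) (hi : i ∉ N) :
    D.LinkedTo N Z x i := by
  have hj := h.notMem
  obtain ⟨r, hr, hv, h⟩ := h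
  cases h with
  | refl => exact .of_visible hi (hv.head hij hj)
  | tail hrk hkj =>
    obtain ⟨hk, -, z, hz, hzk, hzj⟩ := hkj
    exact ⟨r, hr, hv, hrk.tail ⟨hk, hi, z, hz, hzk, hzj.head hij hj⟩⟩

theorem carries_or_visible (hi : i ∉ insert x Z)
    (h : i ∈ ancestralSet (D.BackdoorAdj x) ({x, y} ∪ Z)) :
    D.Carries (insert x Z) i y ∨ ∃ s ∈ insert x Z, D.Visible (insert x Z) s i := by
  obtain ⟨s, hs, h⟩ := h
  induction h using Relation.ReflTransGen.head_induction_on with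
  | refl =>
    obtain (rfl | rfl) | hs := hs
    · exact absurd (Set.mem_insert _ _) hi
    · exact .inl .refl
    · exact absurd (Set.mem_insert_of_mem _ hs) hi
  | @head i j hij _ ih =>
    by_cases hj : j ∈ insert x Z
    · exact .inr ⟨j, hj, .of_adj hij.1⟩
    · obtain h | ⟨s, hs, h⟩ := ih hj
      exacts [.inl (.head ⟨hij.1, hj⟩ h), .inr ⟨s, hs, h.head hij.1 hj⟩]

theorem LinkedTo.carries_or_linkedTo (h : D.LinkedTo (insert x Z) Z x i) (hij : D.Adj i j)
    (hj : j ∉ insert x Z) (hjW : j ∈ ancestralSet (D.BackdoorAdj x) ({x, y} ∪ Z)) :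
    D.Carries (insert x Z) i y ∨ D.LinkedTo (insert x Z) Z x j := by
  obtain h' | ⟨s, rfl | hs, h'⟩ := carries_or_visible hj hjW
  · exact .inl (.head ⟨hij, hj⟩ h')
  · exact .inr (.of_visible hj h')
  · exact .inr (h.tail ⟨h.notMem, hj, s, hs, h'.head hij hj, h'⟩)

theorem LinkedTo.of_moralAdj_self (hj : j ∉ N)
    (h : MoralAdj (D.BackdoorAdj x) W C x j) : D.LinkedTo N Z x j := by
  obtain ⟨-, -, h | h | ⟨s, -, h, -⟩⟩ := h
  exacts [absurd rfl h.2, .of_visible hj (.of_adj h.1), absurd rfl h.2]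

theorem LinkedTo.carries_or_of_moralAdj (h : D.LinkedTo (insert x Z) Z x i)
    (hij : MoralAdj (D.BackdoorAdj x) (ancestralSet (D.BackdoorAdj x) ({x, y} ∪ Z)) C i j)
    (hj : j ∉ insert x Z) :
    D.Carries (insert x Z) i y ∨ D.LinkedTo (insert x Z) Z x j := by
  obtain ⟨-, ⟨hjW, -⟩, hij | hji | ⟨s, hsW, his, hjs⟩⟩ := hij
  · exact h.carries_or_linkedTo hij.1 hj hjW
  · exact .inr (h.of_adj hji.1 hj)
  · by_cases hs : s ∈ insert x Z
    · obtain rfl | hsZ := hs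
      · exact .inr (.of_visible hj (.of_adj hjs.1))
      · exact .inr (h.tail ⟨h.notMem, hj, s, hsZ, .of_adj his.1, .of_adj hjs.1⟩)
    · exact (h.carries_or_linkedTo his.1 hs hsW).imp_right fun h' => h'.of_adj hjs.1 hj

theorem exists_linkedTo_carries (hxy : x ≠ y)
    (h : MoralConn (D.BackdoorAdj x) (ancestralSet (D.BackdoorAdj x) ({x, y} ∪ Z)) Z x y) :
    ∃ i, D.LinkedTo (insert x Z) Z x i ∧ D.Carries (insert x Z) i y := by
  have key : ∀ j, MoralConn (D.BackdoorAdj x) (ancestralSet (D.BackdoorAdj x) ({x, y} ∪ Z)) Z x j →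
      j = x ∨ (∃ i, D.LinkedTo (insert x Z) Z x i ∧ D.Carries (insert x Z) i y) ∨
        D.LinkedTo (insert x Z) Z x j := by
    intro j hj
    induction hj with
    | refl => exact .inl rfl
    | @tail i j _ hij ih =>
      refine or_iff_not_imp_left.2 fun hjx => ?_
      have hj : j ∉ insert x Z := fun h => h.elim hjx hij.2.1.2
      obtain rfl | ih | ih := ih
      · exact .inr (.of_moralAdj_self hj hij)
      · exact .inl ih
      · exact (ih.carries_or_of_moralAdj hij hj).imp_left fun h' => ⟨i, ih, h'⟩
  obtain h | h | h := key y h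
  exacts [absurd h.symm hxy, h, ⟨y, h, .refl⟩]

end DAG

/-! ### Partial integrals -/

section Lmarginal

variable {V : Type v} [DecidableEq V] {Ω : V → Type u} {s t : Finset V} {A : Set V}

theorem updateFinset_apply_of_notMem (w : ∀ i, Ω i) (y : ∀ i : s, Ω i) {i : V} (hi : i ∉ s) :
    Function.updateFinset w s y i = w i :=
  dif_neg hi

variable [∀ i, MeasurableSpace (Ω i)] {μ : ∀ i, Measure (Ω i)} {f g : (∀ i, Ω i) → ℝ≥0∞}

theorem lmarginal_mul_left (hf : Measurable f) (hg : DependsOn g A) (hA : ∀ i ∈ s, i ∉ A)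
    (w : ∀ i, Ω i) : lmarginal μ s (fun w => g w * f w) w = g w * lmarginal μ s f w := by
  have hm : Measurable fun y => f (Function.updateFinset w s y) := hf.comp measurable_updateFinset
  unfold lmarginal
  rw [← lintegral_const_mul _ hm]
  refine lintegral_congr fun y => congrArg (· * _) (hg fun i hi => ?_)
  exact updateFinset_apply_of_notMem w y fun his => hA i his hi

theorem dependsOn_lmarginal (hf : DependsOn f A) : DependsOn (lmarginal μ s f) (A \ s) := by
  refine fun w w' h => lintegral_congr fun y => hf fun i hi => ?_
  by_cases his : i ∈ s
  · simp only [Function.updateFinset, his, dite_true]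
  · simp only [updateFinset_apply_of_notMem _ y his, h i ⟨hi, his⟩]

theorem lmarginal_eq_lmarginal_sdiff [∀ i, SigmaFinite (μ i)] (hst : s ⊆ t) (hf : Measurable f) :
    lmarginal μ t f = lmarginal μ s (lmarginal μ (t \ s) f) := by
  rw [← lmarginal_union μ f hf Finset.disjoint_sdiff, Finset.union_sdiff_of_subset hst]

variable [Fintype V] [∀ i, SigmaFinite (μ i)]

theorem lmarginal_lmarginal_compl (hf : Measurable f) (s : Finset V) (w : ∀ i, Ω i) :
    lmarginal μ s (lmarginal μ sᶜ f) w = ∫⁻ w, f w ∂Measure.pi μ := by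
  rw [← lmarginal_union μ f hf disjoint_compl_right, Finset.union_compl, lmarginal_univ]

theorem ae_of_forall_ae_updateFinset (s : Finset V) {P : (∀ i, Ω i) → Prop}
    (hP : MeasurableSet {w | P w})
    (h : ∀ w, ∀ᵐ y ∂Measure.pi (fun i : s => μ i), P (Function.updateFinset w s y)) :
    ∀ᵐ w ∂Measure.pi μ, P w := by
  have hm : Measurable ({w | P w}ᶜ.indicator (1 : (∀ i, Ω i) → ℝ≥0∞)) :=
    measurable_one.indicator hP.compl
  have hs : lmarginal μ s ({w | P w}ᶜ.indicator (1 : (∀ i, Ω i) → ℝ≥0∞)) = 0 := by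
    funext w
    refine (lintegral_congr_ae ?_).trans lintegral_zero
    filter_upwards [h w] with y hy
    exact Set.indicator_of_notMem (not_not.2 hy) _
  refine (lintegral_indicator_one hP.compl).symm.trans ?_
  obtain _ | ⟨⟨w⟩⟩ := isEmpty_or_nonempty (∀ i, Ω i)
  · exact lintegral_of_isEmpty _ _
  · rw [← lmarginal_lmarginal_compl hm sᶜ w, compl_compl, hs]
    exact lintegral_zero

theorem ae_ae_updateFinset (s : Finset V) {P : (∀ i, Ω i) → Prop}
    (h : ∀ᵐ w ∂Measure.pi μ, P w) :
    ∀ᵐ w ∂Measure.pi μ, ∀ᵐ y ∂Measure.pi (fun i : s => μ i), P (Function.updateFinset w s y) := by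
  obtain ⟨N, hN, hNm, hN0⟩ := exists_measurable_superset_of_null (ae_iff.1 h)
  have hm : Measurable (N.indicator (1 : (∀ i, Ω i) → ℝ≥0∞)) := measurable_one.indicator hNm
  have hzero : ∀ᵐ w ∂Measure.pi μ,
      lmarginal μ s (N.indicator (1 : (∀ i, Ω i) → ℝ≥0∞)) w = 0 := by
    refine ae_of_forall_ae_updateFinset sᶜ (hm.lmarginal μ (measurableSet_singleton 0)) fun w => ?_
    have h0 := lmarginal_lmarginal_compl (μ := μ) hm sᶜ w
    rw [lintegral_indicator_one hNm, hN0, compl_compl] at h0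
    exact (lintegral_eq_zero_iff ((hm.lmarginal μ).comp measurable_updateFinset)).1 h0
  filter_upwards [hzero] with w hw
  filter_upwards [(lintegral_eq_zero_iff (hm.comp measurable_updateFinset)).1 hw] with y hy
  by_contra hP
  exact one_ne_zero ((Set.indicator_of_mem (hN hP) _).symm.trans hy)

theorem lmarginal_congr_ae (s : Finset V) (h : ∀ᵐ w ∂Measure.pi μ, f w = g w) :
    ∀ᵐ w ∂Measure.pi μ, lmarginal μ s f w = lmarginal μ s g w := by
  filter_upwards [ae_ae_updateFinset s h] with w hw
  exact lintegral_congr_ae hw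

end Lmarginal

/-! ### Marginal densities -/

section Marginals

variable {V : Type v} [Fintype V] {Ω : V → Type u} [∀ i, MeasurableSpace (Ω i)]
  {μ : ∀ i, Measure (Ω i)}

/-- Probability densities that are positive almost everywhere, so that all conditional densities
are ratios of numbers in `(0, ∞)` almost everywhere. -/
structure IsPositiveDensity (μ : ∀ i, Measure (Ω i)) (f : (∀ i, Ω i) → ℝ≥0∞) : Prop where
  measurable : Measurable f
  lintegral_eq_one : ∫⁻ w, f w ∂Measure.pi μ = 1
  pos : ∀ᵐ w ∂Measure.pi μ, 0 < f w

theorem IsPositiveDensity.pi_ne_zero {f : (∀ i, Ω i) → ℝ≥0∞}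
    (hf : IsPositiveDensity μ f) :
    Measure.pi μ ≠ 0 := by
  intro h
  have h1 := hf.lintegral_eq_one
  rw [h, lintegral_zero_measure] at h1
  exact zero_ne_one h1

variable [DecidableEq V]

theorem dependsOn_marginalDensity (f : (∀ i, Ω i) → ℝ≥0∞) (S : Finset V) :
    DependsOn (marginalDensity μ f S) S :=
  fun _ _ h => lmarginal_congr μ f fun i hi => h i (by simpa using hi)

theorem dependsOn_condDensity (f : (∀ i, Ω i) → ℝ≥0∞) (A B : Finset V) :
    DependsOn (condDensity μ f A B) (A ∪ B : Set V) := by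
  intro w w' h
  have hAB := dependsOn_marginalDensity (μ := μ) f (A ∪ B) (x := w) (y := w')
    fun i hi => h i (by simpa using hi)
  have hB := dependsOn_marginalDensity (μ := μ) f B fun i hi => h i (.inr hi)
  simp only [condDensity, hAB, hB]

theorem IsInterventionalFamily.isPositiveDensity {F : Finset V → (∀ i, Ω i) → ℝ≥0∞}
    (hF : IsInterventionalFamily μ F) : IsPositiveDensity μ (F ∅) :=
  ⟨hF.measurable ∅, hF.lintegral_eq_one, hF.pos⟩

variable [∀ i, SigmaFinite (μ i)] {f g p φ ψ : (∀ i, Ω i) → ℝ≥0∞} {A B C S S' U W : Finset V}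

theorem measurable_marginalDensity (hf : Measurable f) (S : Finset V) :
    Measurable (marginalDensity μ f S) :=
  hf.lmarginal μ

theorem lmarginal_marginalDensity (hf : Measurable f) (h : S ⊆ S') :
    lmarginal μ (S' \ S) (marginalDensity μ f S') = marginalDensity μ f S := by
  have hS : Sᶜ = S' \ S ∪ S'ᶜ := by
    ext i
    have := @h i
    simp only [Finset.mem_union, Finset.mem_sdiff, Finset.mem_compl]
    tauto
  have hdisj : Disjoint (S' \ S) S'ᶜ := disjoint_compl_right.mono_left Finset.sdiff_subset
  simp only [marginalDensity, hS, lmarginal_union μ f hf hdisj]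

theorem measurable_condDensity (hf : Measurable f) (A B : Finset V) :
    Measurable (condDensity μ f A B) :=
  (measurable_marginalDensity hf _).div (measurable_marginalDensity hf _)

theorem marginalDensity_congr_ae (h : ∀ᵐ w ∂Measure.pi μ, f w = g w) (S : Finset V) :
    ∀ᵐ w ∂Measure.pi μ, marginalDensity μ f S w = marginalDensity μ g S w :=
  lmarginal_congr_ae _ h

theorem CondIndepDensity.congr_ae (h : ∀ᵐ w ∂Measure.pi μ, f w = g w)
    (hf : CondIndepDensity μ f A B C) : CondIndepDensity μ g A B C := by
  filter_upwards [hf, marginalDensity_congr_ae h (A ∪ B ∪ C), marginalDensity_congr_ae h C,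
    marginalDensity_congr_ae h (A ∪ C), marginalDensity_congr_ae h (B ∪ C)] with w h0 h1 h2 h3 h4
  rwa [h1, h2, h3, h4] at h0

namespace IsPositiveDensity

theorem marginalDensity_ne_top (hf : IsPositiveDensity μ f) (S : Finset V) :
    ∀ᵐ w ∂Measure.pi μ, marginalDensity μ f S w ≠ ∞ := by
  refine ae_of_forall_ae_updateFinset S
    (measurable_marginalDensity hf.measurable S (measurableSet_singleton ∞)).compl fun w => ?_
  have h : lmarginal μ S (lmarginal μ Sᶜ f) w ≠ ∞ := by
    rw [lmarginal_lmarginal_compl hf.measurable, hf.lintegral_eq_one]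
    exact ENNReal.one_ne_top
  filter_upwards [ae_lt_top ((hf.measurable.lmarginal μ).comp measurable_updateFinset) h] with y hy
  exact hy.ne

theorem marginalDensity_ne_zero (hf : IsPositiveDensity μ f) (S : Finset V) :
    ∀ᵐ w ∂Measure.pi μ, marginalDensity μ f S w ≠ 0 := by
  have : NeZero (Measure.pi fun i : (Sᶜ : Finset V) => μ i) := by
    refine ⟨fun h0 => hf.pi_ne_zero ?_⟩
    rw [← Measure.measure_univ_eq_zero, Measure.pi_univ] at h0 ⊢
    obtain ⟨i, -, hi⟩ := Finset.prod_eq_zero_iff.1 h0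
    exact Finset.prod_eq_zero (Finset.mem_univ _) hi
  filter_upwards [ae_ae_updateFinset Sᶜ hf.pos] with w hw h0
  obtain ⟨y, hy, hy0⟩ :=
    (hw.and ((lintegral_eq_zero_iff (hf.measurable.comp measurable_updateFinset)).1 h0)).exists
  exact hy.ne' hy0

theorem condDensity_mul_marginalDensity (hf : IsPositiveDensity μ f) (A B C : Finset V) :
    ∀ᵐ w ∂Measure.pi μ, condDensity μ f A (B ∪ C) w * marginalDensity μ f C w =
      marginalDensity μ f (A ∪ (B ∪ C)) w / condDensity μ f B C w := by
  filter_upwards [hf.marginalDensity_ne_zero (B ∪ C), hf.marginalDensity_ne_top (B ∪ C)]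
    with w h0 htop
  simp only [condDensity, div_eq_mul_inv]
  rw [ENNReal.mul_inv (.inl h0) (.inl htop), inv_inv, mul_assoc]

end IsPositiveDensity

theorem CondIndepDensity.condDensity_union (hf : IsPositiveDensity μ f)
    (h : CondIndepDensity μ f A B C) :
    ∀ᵐ w ∂Measure.pi μ, condDensity μ f A (B ∪ C) w = condDensity μ f A C w := by
  filter_upwards [h, hf.marginalDensity_ne_zero (B ∪ C), hf.marginalDensity_ne_top (B ∪ C),
    hf.marginalDensity_ne_zero C, hf.marginalDensity_ne_top C] with w h h0 htop h0' htop'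
  rw [condDensity, condDensity, ENNReal.div_eq_div_iff h0' htop' h0 htop, mul_comm,
    ← Finset.union_assoc, h, mul_comm]

/-! ### Conditional independence from a factorization -/

theorem marginalDensity_eq_mul (hp : Measurable p) (hφ : Measurable φ) (hψ : Measurable ψ)
    (hφU : DependsOn φ (U ∪ C : Set V)) (hψU : DependsOn ψ (U : Set V)ᶜ)
    (hW : ∀ w, marginalDensity μ p W w = φ w * ψ w) (hCS : C ⊆ S) (hSW : S ⊆ W) (w : ∀ i, Ω i) :
    marginalDensity μ p S w =
      lmarginal μ ((W \ S) ∩ U) φ w * lmarginal μ ((W \ S) \ U) ψ w := by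
  have hψ_out : lmarginal μ ((W \ S) \ U) (fun w => φ w * ψ w) =
      fun w => lmarginal μ ((W \ S) \ U) ψ w * φ w := by
    funext w
    rw [lmarginal_mul_left hψ hφU, mul_comm]
    intro i hi
    rw [Finset.mem_sdiff, Finset.mem_sdiff] at hi
    rintro (h | h)
    exacts [hi.2 h, hi.1.2 (hCS h)]
  have hm : Measurable fun w => φ w * ψ w := hφ.mul hψ
  rw [← lmarginal_marginalDensity hp hSW, funext hW,
    lmarginal_eq_lmarginal_sdiff Finset.inter_subset_left hm,
    Finset.sdiff_inter_self_left, hψ_out, lmarginal_mul_left hφ (dependsOn_lmarginal hψU), mul_comm]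
  exact fun i hi h => h.1 (Finset.mem_inter.1 hi).2

theorem condIndepDensity_of_eq_mul (hp : Measurable p) (hφ : Measurable φ) (hψ : Measurable ψ)
    (hφU : DependsOn φ (U ∪ C : Set V)) (hψU : DependsOn ψ (U : Set V)ᶜ)
    (hW : ∀ w, marginalDensity μ p W w = φ w * ψ w) (hABC : A ∪ B ∪ C ⊆ W)
    (hA : A ⊆ U) (hB : Disjoint B U) : CondIndepDensity μ p A B C := by
  refine Filter.Eventually.of_forall fun w => ?_
  have key : ∀ S, C ⊆ S → S ⊆ W → marginalDensity μ p S w =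
      lmarginal μ ((W \ S) ∩ U) φ w * lmarginal μ ((W \ S) \ U) ψ w :=
    fun S h1 h2 => marginalDensity_eq_mul hp hφ hψ hφU hψU hW h1 h2 w
  have hin : ∀ S, (W \ (B ∪ S)) ∩ U = (W \ S) ∩ U := by
    intro S
    ext i
    have : i ∈ B → i ∉ U := fun h => Finset.disjoint_left.1 hB h
    simp only [Finset.mem_inter, Finset.mem_sdiff, Finset.mem_union]
    tauto
  have hout : ∀ S, (W \ (A ∪ S)) \ U = (W \ S) \ U := by
    intro S
    ext i
    have := @hA i
    simp only [Finset.mem_sdiff, Finset.mem_union]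
    tauto
  have hAC : A ∪ C ⊆ W := (Finset.union_subset_union_left Finset.subset_union_left).trans hABC
  have hBC : B ∪ C ⊆ W := (Finset.union_subset_union_left Finset.subset_union_right).trans hABC
  rw [key _ Finset.subset_union_right hABC, key C subset_rfl (Finset.subset_union_right.trans hAC),
    key _ Finset.subset_union_right hAC, key _ Finset.subset_union_right hBC, hin C, hout C,
    Finset.union_assoc A B C, hout (B ∪ C), Finset.union_left_comm, hin (A ∪ C)]
  ring

end Marginals

/-! ### Products of kernels along a directed acyclic graph -/

section Kernels

variable {V : Type v} [DecidableEq V] {Ω : V → Type u}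
  [∀ i, MeasurableSpace (Ω i)] {μ : ∀ i, Measure (Ω i)}

/-- A Markov kernel for each variable given its parents: `k i` is a probability density in the
coordinate `i` for every value of the parents of `i`, and is a function of these coordinates. -/
structure DAG.IsKernelFamily (D : DAG V) (μ : ∀ i, Measure (Ω i))
    (k : V → (∀ i, Ω i) → ℝ≥0∞) : Prop where
  measurable : ∀ i, Measurable (k i)
  dependsOn : ∀ i, DependsOn (k i) (insert i {j | D.Adj j i})
  lmarginal_eq_one : ∀ i w, lmarginal μ {i} (k i) w = 1

namespace DAG.IsKernelFamily

variable {D : DAG V} {k : V → (∀ i, Ω i) → ℝ≥0∞} {A B C S U W : Finset V} {i : V}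

theorem measurable_prod (hk : D.IsKernelFamily μ k) (B : Finset V) :
    Measurable fun w => ∏ i ∈ B, k i w :=
  Finset.measurable_fun_prod B fun i _ => hk.measurable i

theorem dependsOn_prod (hk : D.IsKernelFamily μ k) {s : Set V}
    (h : ∀ i ∈ B, insert i {j | D.Adj j i} ⊆ s) : DependsOn (fun w => ∏ i ∈ B, k i w) s :=
  fun _ _ hw => Finset.prod_congr rfl fun i hi => hk.dependsOn i fun j hj => hw j (h i hi hj)

theorem lmarginal_singleton_prod (hk : D.IsKernelFamily μ k) (hi : i ∈ B)
    (h : ∀ j ∈ B, ¬ D.Adj i j) :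
    lmarginal μ {i} (fun w => ∏ j ∈ B, k j w) = fun w => ∏ j ∈ B.erase i, k j w := by
  have hdep : DependsOn (fun w => ∏ j ∈ B.erase i, k j w) ({i}ᶜ : Set V) := by
    refine hk.dependsOn_prod fun j hj m hm => ?_
    obtain ⟨hji, hjB⟩ := Finset.mem_erase.1 hj
    rintro rfl
    obtain hm | hm := hm
    exacts [hji hm.symm, h j hjB hm]
  funext w
  have hsplit : (fun w => ∏ j ∈ B, k j w) = fun w => (∏ j ∈ B.erase i, k j w) * k i w :=
    funext fun w => (Finset.prod_erase_mul B (fun j => k j w) hi).symm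
  rw [hsplit, lmarginal_mul_left (hk.measurable i) hdep (by simp), hk.lmarginal_eq_one, mul_one]

variable [∀ i, SigmaFinite (μ i)]

theorem lmarginal_prod [Finite V] (hk : D.IsKernelFamily μ k) (hAB : A ⊆ B)
    (h : ∀ i ∈ A, ∀ j ∈ B, D.Adj i j → j ∈ A) :
    lmarginal μ A (fun w => ∏ i ∈ B, k i w) = fun w => ∏ i ∈ B \ A, k i w := by
  induction A using Finset.strongInduction generalizing B with
  | H A ih =>
    obtain rfl | hA := A.eq_empty_or_nonempty
    · simp
    obtain ⟨i, hi, hmax⟩ := (wellFounded_swap_transGen D.acyclic).has_min (A : Set V) hA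
    have hsink : ∀ j ∈ B, ¬ D.Adj i j := fun j hj hij => hmax j (h i hi j hj hij) (.single hij)
    have herase : ∀ m ∈ A.erase i, ∀ j ∈ B.erase i, D.Adj m j → j ∈ A.erase i := by
      intro m hm j hj hmj
      rw [Finset.mem_erase] at hm hj ⊢
      exact ⟨hj.1, h m hm.2 j hj.2 hmj⟩
    have hsdiff : B.erase i \ A.erase i = B \ A := by
      ext j
      have : j = i → j ∈ A := fun hj => hj ▸ hi
      simp only [Finset.mem_sdiff, Finset.mem_erase]
      tauto
    calc lmarginal μ A (fun w => ∏ j ∈ B, k j w)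
        = lmarginal μ (A.erase i) (lmarginal μ {i} fun w => ∏ j ∈ B, k j w) := by
          rw [← lmarginal_union μ _ (hk.measurable_prod B) (by simp), Finset.union_comm,
            ← Finset.insert_eq, Finset.insert_erase hi]
      _ = fun w => ∏ j ∈ B.erase i \ A.erase i, k j w := by
          rw [hk.lmarginal_singleton_prod (hAB hi) hsink]
          exact ih _ (Finset.erase_ssubset hi) (Finset.erase_subset_erase i hAB) herase
      _ = fun w => ∏ j ∈ B \ A, k j w := by rw [hsdiff]

variable [Fintype V]

theorem marginalDensity_prod (hk : D.IsKernelFamily μ k)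
    (hW : ∀ i j, D.Adj i j → j ∈ W → i ∈ W) :
    marginalDensity μ (fun w => ∏ i, k i w) W = fun w => ∏ i ∈ W, k i w := by
  have h : ∀ i ∈ Wᶜ, ∀ j ∈ Finset.univ, D.Adj i j → j ∈ Wᶜ := by
    intro i hi j _ hij
    rw [Finset.mem_compl] at hi ⊢
    exact fun hj => hi (hW i j hij hj)
  rw [marginalDensity, hk.lmarginal_prod (Finset.subset_univ _) h,
    ← Finset.compl_eq_univ_sdiff, compl_compl]

theorem condIndepDensity_of_forall_mem (hk : D.IsKernelFamily μ k)
    (hW : ∀ i j, D.Adj i j → j ∈ W → i ∈ W)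
    (hU : ∀ i ∈ W, ∀ m ∈ insert i {j | D.Adj j i}, ∀ n ∈ insert i {j | D.Adj j i},
      m ∈ U → n ∉ C → n ∈ U)
    (hABC : A ∪ B ∪ C ⊆ W) (hA : A ⊆ U) (hB : Disjoint B U) :
    CondIndepDensity μ (fun w => ∏ i, k i w) A B C := by
  classical
  let meets (i : V) : Prop := ∃ m ∈ U, m ∈ insert i {j | D.Adj j i}
  have hprod : ∀ w, marginalDensity μ (fun w => ∏ i, k i w) W w =
      (∏ i ∈ W with meets i, k i w) * ∏ i ∈ W with ¬ meets i, k i w := by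
    intro w
    rw [hk.marginalDensity_prod hW, Finset.prod_filter_mul_prod_filter_not]
  refine condIndepDensity_of_eq_mul (hk.measurable_prod _) (hk.measurable_prod _)
    (hk.measurable_prod _) (hk.dependsOn_prod ?_) (hk.dependsOn_prod ?_) hprod hABC hA hB
  · intro i hi n hn
    obtain ⟨hiW, m, hmU, hm⟩ := Finset.mem_filter.1 hi
    exact or_iff_not_imp_right.2 (hU i hiW m hm n hn hmU)
  · intro i hi n hn hnU
    exact (Finset.mem_filter.1 hi).2 ⟨n, hnU, hn⟩

theorem condIndepDensity (hk : D.IsKernelFamily μ k) (hAC : Disjoint A C)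
    (h : ∀ a ∈ A, ∀ b ∈ B,
      ¬ MoralConn D.Adj (ancestralSet D.Adj (A ∪ B ∪ C : Set V)) C a b) :
    CondIndepDensity μ (fun w => ∏ i, k i w) A B C := by
  classical
  set W := ancestralSet D.Adj (A ∪ B ∪ C : Set V)
  have hABC : (A ∪ B ∪ C : Set V) ⊆ W := subset_ancestralSet _ _
  let U : Set V := {i | i ∈ W ∧ i ∉ C ∧ ∃ a ∈ A, MoralConn D.Adj W C a i}
  have hU : ∀ i ∈ W, ∀ m ∈ insert i {j | D.Adj j i}, ∀ n ∈ insert i {j | D.Adj j i},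
      m ∈ U → n ∉ C → n ∈ U := by
    rintro i hi m hm n hn ⟨hmW, hmC, a, ha, ham⟩ hnC
    have hnW : n ∈ W := hn.elim (fun h => h ▸ hi) fun h => mem_ancestralSet_of_rel h hi
    refine ⟨hnW, hnC, a, ha, ?_⟩
    obtain rfl | hm := hm <;> obtain rfl | hn := hn
    · exact ham
    · exact .tail ham ⟨⟨hmW, hmC⟩, ⟨hnW, hnC⟩, .inr (.inl hn)⟩
    · exact .tail ham ⟨⟨hmW, hmC⟩, ⟨hnW, hnC⟩, .inl hm⟩
    · exact .tail ham ⟨⟨hmW, hmC⟩, ⟨hnW, hnC⟩, .inr (.inr ⟨i, hi, hm, hn⟩)⟩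
  refine hk.condIndepDensity_of_forall_mem (W := W.toFinset) (U := U.toFinset) ?_ ?_ ?_ ?_ ?_
  · simpa only [Set.mem_toFinset] using fun i j => mem_ancestralSet_of_rel
  · simpa only [Set.mem_toFinset] using hU
  · simpa only [Set.subset_toFinset, Finset.coe_union] using hABC
  · rw [Set.subset_toFinset]
    exact fun a ha => ⟨hABC (.inl (.inl ha)), Finset.disjoint_left.1 hAC ha, a, ha, .refl⟩
  · rw [Finset.disjoint_left]
    simp only [Set.mem_toFinset]
    rintro b hb ⟨-, -, a, ha, hab⟩
    exact h a ha b hb hab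

theorem marginalDensity_singleton_union (hk : D.IsKernelFamily μ k)
    (hS : ∀ j, D.Adj j i → j ∈ S) (hi : ∀ j ∈ S, ¬ D.IsAncestor i j) (w : ∀ i, Ω i) :
    marginalDensity μ (fun w => ∏ i, k i w) ({i} ∪ S) w =
      k i w * marginalDensity μ (fun w => ∏ i, k i w) S w := by
  classical
  let W : Finset V := {j | ¬ Relation.TransGen D.Adj i j}
  have memW : ∀ j, j ∈ W ↔ ¬ Relation.TransGen D.Adj i j := by simp [W]
  have hiW : i ∈ W := (memW i).2 (D.acyclic i)
  have hW : ∀ j l, D.Adj j l → l ∈ W → j ∈ W :=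
    fun j l hjl hl => (memW j).2 fun h => (memW l).1 hl (h.tail hjl)
  have hWi : ∀ j l, D.Adj j l → l ∈ W.erase i → j ∈ W.erase i := by
    intro j l hjl hl
    rw [Finset.mem_erase] at hl ⊢
    refine ⟨?_, hW j l hjl hl.2⟩
    rintro rfl
    exact (memW l).1 hl.2 (.single hjl)
  have hSW : S ⊆ W.erase i := fun j hj =>
    Finset.mem_erase.2 ⟨fun h => hi j hj (h ▸ .refl), (memW j).2 fun h => hi j hj h.to_reflTransGen⟩
  have hiSW : {i} ∪ S ⊆ W :=
    Finset.union_subset (Finset.singleton_subset_iff.2 hiW) (hSW.trans (Finset.erase_subset _ _))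
  have hsdiff : W \ ({i} ∪ S) = W.erase i \ S := by
    rw [← Finset.insert_eq, Finset.sdiff_insert, Finset.erase_sdiff_comm]
  have hprod := hk.measurable_prod Finset.univ
  rw [← lmarginal_marginalDensity hprod hiSW, ← lmarginal_marginalDensity hprod hSW,
    hk.marginalDensity_prod hW, hk.marginalDensity_prod hWi, hsdiff,
    ← lmarginal_mul_left (hk.measurable_prod _) (hk.dependsOn i)]
  · congr 1
    exact funext fun w => (Finset.mul_prod_erase W (fun j => k j w) hiW).symm
  · rintro j hj (rfl | hji)
    · simp at hj
    · exact (Finset.mem_sdiff.1 hj).2 (hS j hji)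

theorem marginalDensity_singleton_union_parents (hk : D.IsKernelFamily μ k) (i : V)
    (w : ∀ i, Ω i) :
    marginalDensity μ (fun w => ∏ i, k i w) ({i} ∪ D.parents i) w =
      k i w * marginalDensity μ (fun w => ∏ i, k i w) (D.parents i) w := by
  have mem_parents : ∀ j, j ∈ D.parents i ↔ D.Adj j i := by simp [DAG.parents]
  refine hk.marginalDensity_singleton_union (fun j => (mem_parents j).2) (fun j hj hij => ?_) w
  exact D.acyclic i (.tail' hij ((mem_parents j).1 hj))

end DAG.IsKernelFamily

end Kernels

/-! ### Densities consistent with a directed acyclic graph -/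

section Consistent

variable {V : Type v} [Fintype V] [DecidableEq V] {Ω : V → Type u}
  [∀ i, MeasurableSpace (Ω i)] {μ : ∀ i, Measure (Ω i)} [∀ i, SigmaFinite (μ i)]
  {D : DAG V} {F : Finset V → (∀ i, Ω i) → ℝ≥0∞} {A B C : Finset V}

theorem exists_ae_eq_lmarginal_singleton_eq_one {c : (∀ i, Ω i) → ℝ≥0∞} {i : V} {s : Set V}
    (hμ : Measure.pi μ ≠ 0) (hc : Measurable c) (hcs : DependsOn c s) (hi : i ∈ s)
    (h : ∀ᵐ w ∂Measure.pi μ, lmarginal μ {i} c w = 1) :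
    ∃ k : (∀ i, Ω i) → ℝ≥0∞, Measurable k ∧ DependsOn k s ∧ (∀ w, lmarginal μ {i} k w = 1) ∧
      ∀ᵐ w ∂Measure.pi μ, k w = c w := by
  classical
  have : (ae (Measure.pi μ)).NeBot := ae_neBot.2 hμ
  obtain ⟨w₀, hw₀⟩ := h.exists
  -- Where `c` is not normalized, use its normalized section at `w₀` instead.
  let k : (∀ i, Ω i) → ℝ≥0∞ := fun w =>
    if lmarginal μ {i} c w = 1 then c w else c (Function.update w₀ i (w i))
  refine ⟨k, ?_, fun w w' hw => ?_, fun w => ?_, ?_⟩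
  · exact Measurable.ite (hc.lmarginal μ (measurableSet_singleton 1)) hc
      (hc.comp ((measurable_update w₀).comp (measurable_pi_apply i)))
  · have hmarginal : lmarginal μ {i} c w = lmarginal μ {i} c w' :=
      dependsOn_lmarginal hcs fun j hj => hw j hj.1
    simp only [k, hmarginal, hcs hw, hw i hi]
  · rw [lmarginal_singleton] at hw₀ ⊢
    simp only [k, lmarginal_update_of_mem μ (Finset.mem_singleton_self i), Function.update_self]
    split_ifs with hw
    · rwa [lmarginal_singleton] at hw
    · simpa only [Function.update_idem] using hw₀
  · filter_upwards [h] with w hw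
    exact if_pos hw

namespace DAG.IsCompatible

theorem lmarginal_singleton_condDensity (hF : IsInterventionalFamily μ F)
    (hD : D.IsCompatible μ F) (i : V) :
    ∀ᵐ w ∂Measure.pi μ, lmarginal μ {i} (condDensity μ (F ∅) {i} (D.parents i)) w = 1 := by
  have hcond : ∀ᵐ w ∂Measure.pi μ, F {i}ᶜ w = condDensity μ (F ∅) {i} (D.parents i) w := by
    filter_upwards [hD {i}ᶜ] with w hw
    simpa only [compl_compl, Finset.prod_singleton] using hw
  filter_upwards [hF.normalized {i}ᶜ, lmarginal_congr_ae {i} hcond] with w hnorm hw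
  rwa [compl_compl, hw] at hnorm

theorem exists_isKernelFamily (hF : IsInterventionalFamily μ F) (hD : D.IsCompatible μ F) :
    ∃ k, D.IsKernelFamily μ k ∧ ∀ᵐ w ∂Measure.pi μ, ∏ i, k i w = F ∅ w := by
  have hdep : ∀ i, DependsOn (condDensity μ (F ∅) {i} (D.parents i))
      (insert i {j | D.Adj j i}) := by
    intro i
    simpa [DAG.parents] using dependsOn_condDensity (μ := μ) (F ∅) {i} (D.parents i)
  choose k hkm hkd hk1 hkc using fun i => exists_ae_eq_lmarginal_singleton_eq_one
    hF.isPositiveDensity.pi_ne_zero (measurable_condDensity (hF.measurable ∅) {i} (D.parents i))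
    (hdep i) (Set.mem_insert i _) (hD.lmarginal_singleton_condDensity hF i)
  refine ⟨k, ⟨hkm, hkd, hk1⟩, ?_⟩
  filter_upwards [hD ∅, ae_all_iff.2 hkc] with w hw hkw
  rw [hw, Finset.compl_empty]
  exact Finset.prod_congr rfl fun i _ => hkw i

theorem condIndepDensity (hF : IsInterventionalFamily μ F) (hD : D.IsCompatible μ F)
    (hAC : Disjoint A C)
    (h : ∀ a ∈ A, ∀ b ∈ B,
      ¬ MoralConn D.Adj (ancestralSet D.Adj (A ∪ B ∪ C : Set V)) C a b) :
    CondIndepDensity μ (F ∅) A B C := by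
  obtain ⟨k, hk, hkF⟩ := hD.exists_isKernelFamily hF
  exact (hk.condIndepDensity hAC h).congr_ae hkF

end DAG.IsCompatible

theorem DAG.DSep.condIndepDensity (hF : IsInterventionalFamily μ F) (hD : D.IsCompatible μ F)
    (hAC : Disjoint A C) (h : D.DSep A B C) : CondIndepDensity μ (F ∅) A B C :=
  hD.condIndepDensity hF hAC fun _ ha _ hb => h.not_moralConn ha hb

/-! ### Shrinking an adjustment set -/

variable {f : (∀ i, Ω i) → ℝ≥0∞} {X Y T Z : Finset V}

theorem CondIndepDensity.lmarginal_sdiff_of_outcome (hf : IsPositiveDensity μ f)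
    (hXT : Disjoint X T) (hYT : Disjoint Y T) (hZT : Z ⊆ T)
    (h : CondIndepDensity μ f Y T (Z ∪ X)) :
    ∀ᵐ w ∂Measure.pi μ,
      lmarginal μ (T \ Z) (fun w => condDensity μ f Y (X ∪ T) w * marginalDensity μ f T w) w =
        condDensity μ f Y (X ∪ Z) w * marginalDensity μ f Z w := by
  have hunion : T ∪ (Z ∪ X) = X ∪ T := by
    rw [← Finset.union_assoc, Finset.union_eq_left.2 hZT, Finset.union_comm]
  have hcond : ∀ᵐ w ∂Measure.pi μ, condDensity μ f Y (X ∪ T) w * marginalDensity μ f T w =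
      condDensity μ f Y (X ∪ Z) w * marginalDensity μ f T w := by
    filter_upwards [h.condDensity_union hf] with w hw
    rw [← hunion, hw, Finset.union_comm Z X]
  filter_upwards [lmarginal_congr_ae (T \ Z) hcond] with w hw
  rw [hw, lmarginal_mul_left (measurable_marginalDensity hf.measurable T)
    (dependsOn_condDensity f Y (X ∪ Z)), lmarginal_marginalDensity hf.measurable hZT]
  intro i hi
  obtain ⟨hiT, hiZ⟩ := Finset.mem_sdiff.1 hi
  simp [Finset.disjoint_right.1 hXT hiT, Finset.disjoint_right.1 hYT hiT, hiZ]

theorem CondIndepDensity.lmarginal_sdiff_of_treatment (hf : IsPositiveDensity μ f)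
    (hXT : Disjoint X T) (hYT : Disjoint Y T) (hZT : Z ⊆ T) (h : CondIndepDensity μ f X T Z) :
    ∀ᵐ w ∂Measure.pi μ,
      lmarginal μ (T \ Z) (fun w => condDensity μ f Y (X ∪ T) w * marginalDensity μ f T w) w =
        condDensity μ f Y (X ∪ Z) w * marginalDensity μ f Z w := by
  have hcond : ∀ᵐ w ∂Measure.pi μ, condDensity μ f Y (X ∪ T) w * marginalDensity μ f T w =
      (condDensity μ f X Z w)⁻¹ * marginalDensity μ f (Y ∪ (X ∪ T)) w := by
    filter_upwards [h.condDensity_union hf, hf.condDensity_mul_marginalDensity Y X T] with w hw hT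
    rw [Finset.union_eq_left.2 hZT] at hw
    rw [hT, hw, div_eq_mul_inv, mul_comm]
  have hdep : DependsOn (fun w => (condDensity μ f X Z w)⁻¹) (X ∪ Z : Set V) :=
    fun _ _ hw => congrArg (·⁻¹) (dependsOn_condDensity f X Z hw)
  have hsdiff : T \ Z = (Y ∪ (X ∪ T)) \ (Y ∪ (X ∪ Z)) := by
    ext i
    have hX : i ∈ T → i ∉ X := fun hi => Finset.disjoint_right.1 hXT hi
    have hY : i ∈ T → i ∉ Y := fun hi => Finset.disjoint_right.1 hYT hi
    simp only [Finset.mem_sdiff, Finset.mem_union]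
    tauto
  filter_upwards [lmarginal_congr_ae (T \ Z) hcond, hf.condDensity_mul_marginalDensity Y X Z]
    with w hw hZ
  rw [hw, hZ, lmarginal_mul_left (measurable_marginalDensity hf.measurable _) hdep, hsdiff,
    lmarginal_marginalDensity hf.measurable (by gcongr), div_eq_mul_inv, mul_comm]
  intro i hi
  obtain ⟨hiT, hiZ⟩ := Finset.mem_sdiff.1 hi
  simp [Finset.disjoint_right.1 hXT hiT, hiZ]

theorem AdjustmentFormula.of_condIndepDensity (hF : IsInterventionalFamily μ F)
    (hXT : Disjoint X T) (hYT : Disjoint Y T) (hZT : Z ⊆ T)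
    (h : CondIndepDensity μ (F ∅) Y T (Z ∪ X) ∨ CondIndepDensity μ (F ∅) X T Z)
    (hT : AdjustmentFormula μ F X Y T) : AdjustmentFormula μ F X Y Z := by
  have hf := hF.isPositiveDensity
  have hsdiff := h.elim (·.lmarginal_sdiff_of_outcome hf hXT hYT hZT)
    (·.lmarginal_sdiff_of_treatment hf hXT hYT hZT)
  have hm : Measurable fun w => condDensity μ (F ∅) Y (X ∪ T) w * marginalDensity μ (F ∅) T w :=
    (measurable_condDensity hf.measurable _ _).mul (measurable_marginalDensity hf.measurable _)
  filter_upwards [hT, lmarginal_congr_ae Z hsdiff] with w hw hZ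
  rw [hw, ← hZ, lmarginal_eq_lmarginal_sdiff hZT hm]

end Consistent

/-! ### The adjustment formula for products of kernels -/

section KernelModels

variable {V : Type v} [Fintype V] [DecidableEq V] {Ω : V → Type u}
  [∀ i, MeasurableSpace (Ω i)] {μ : ∀ i, Measure (Ω i)} [∀ i, SigmaFinite (μ i)]
  {D : DAG V} {k : V → (∀ i, Ω i) → ℝ≥0∞} {x y : V} {Z : Finset V}

namespace DAG.IsKernelFamily

variable [Nonempty (∀ i, Ω i)]

theorem isInterventionalFamily (hk : D.IsKernelFamily μ k) (hpos : ∀ i w, 0 < k i w) :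
    IsInterventionalFamily μ fun S w => ∏ i ∈ Sᶜ, k i w where
  measurable _ := hk.measurable_prod _
  lintegral_eq_one := by
    obtain ⟨w⟩ := ‹Nonempty (∀ i, Ω i)›
    rw [lintegral_eq_lmarginal_univ w, hk.lmarginal_prod (by simp) (by simp), Finset.compl_empty,
      sdiff_self]
    exact Finset.prod_empty
  normalized S := .of_forall fun w => by
    rw [hk.lmarginal_prod subset_rfl fun _ _ _ hj _ => hj, sdiff_self]
    exact Finset.prod_empty
  pos := .of_forall fun w =>
    pos_iff_ne_zero.2 (Finset.prod_ne_zero_iff.2 fun i _ => (hpos i w).ne')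

theorem isCompatible (hk : D.IsKernelFamily μ k) (hpos : ∀ i w, 0 < k i w) :
    D.IsCompatible μ fun S w => ∏ i ∈ Sᶜ, k i w := by
  intro S
  have hf := (hk.isInterventionalFamily hpos).isPositiveDensity
  filter_upwards [ae_all_iff.2 fun i => hf.marginalDensity_ne_zero (D.parents i),
    ae_all_iff.2 fun i => hf.marginalDensity_ne_top (D.parents i)] with w h0 htop
  refine Finset.prod_congr rfl fun i _ => ?_
  simp only [Finset.compl_empty] at h0 htop
  rw [condDensity, Finset.compl_empty, hk.marginalDensity_singleton_union_parents,
    ENNReal.mul_div_cancel_right (h0 i) (htop i)]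

theorem exists_dependsOn_compl_ae_eq_adjustment (hk : D.IsKernelFamily μ k)
    (hpos : ∀ i w, 0 < k i w) (hZ : IsAdjustmentSet.{v, u} D {x} {y} Z)
    (hx : ∀ i ≠ x, DependsOn (k i) {x}ᶜ) :
    ∃ L : (∀ i, Ω i) → ℝ≥0∞, DependsOn L {x}ᶜ ∧ ∀ᵐ w ∂Measure.pi μ, L w =
      lmarginal μ Z (fun w => condDensity μ (fun w => ∏ i, k i w) {y} ({x} ∪ Z) w *
        marginalDensity μ (fun w => ∏ i, k i w) Z w) w := by
  refine ⟨lmarginal μ ({x} ∪ {y})ᶜ (fun w => ∏ i ∈ {x}ᶜ, k i w), ?_, ?_⟩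
  · have hprod : DependsOn (fun w => ∏ i ∈ {x}ᶜ, k i w) {x}ᶜ := fun w w' hw =>
      Finset.prod_congr rfl fun i hi => hx i (by simpa using hi) hw
    exact fun w w' hw => dependsOn_lmarginal hprod fun i hi => hw i hi.1
  · obtain ⟨-, -, -, hZ⟩ := hZ
    simpa only [AdjustmentFormula, Finset.compl_empty] using
      hZ Ω μ _ (hk.isInterventionalFamily hpos) (hk.isCompatible hpos)

end DAG.IsKernelFamily

end KernelModels

/-! ### Finite alphabets -/

section FiniteAlphabet

theorem ae_pi_count_iff {V A : Type*} [Fintype V] [Countable A] [MeasurableSpace A]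
    [MeasurableSingletonClass A] {P : (V → A) → Prop} :
    (∀ᵐ w ∂Measure.pi (fun _ : V => (Measure.count : Measure A)), P w) ↔ ∀ w, P w := by
  refine ⟨fun h w => ?_, .of_forall⟩
  by_contra hw
  have hnull : Measure.pi (fun _ : V => (Measure.count : Measure A)) {w} = 0 :=
    measure_mono_null (Set.singleton_subset_iff.2 hw) (ae_iff.1 h)
  simp at hnull

variable {V A B : Type*} [Fintype V] [DecidableEq V] [Fintype A] [DecidableEq A]
  [Fintype B] [DecidableEq B] {p : (V → A) → ℝ} {x y : V} {S S' Z : Finset V} {w w' : V → A}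

/-- The configurations that agree with `w` on `S`. -/
def agreeing (S : Finset V) (w : V → A) : Finset (V → A) := {w' | ∀ i ∈ S, w' i = w i}

/-- The probability of agreeing with `w` on `S`, for the probability weights `p`. -/
def marginalProb (p : (V → A) → ℝ) (S : Finset V) (w : V → A) : ℝ :=
  ∑ w' ∈ agreeing S w, p w'

/-- The adjustment `∑ z, p(y | x, z) p(z)`, as a function of the coordinates `x` and `y`. A term
with `p(x, z) = 0` is zero. -/
noncomputable def adjustedProb (p : (V → A) → ℝ) (x y : V) (Z : Finset V) (w : V → A) : ℝ :=
  ∑ w' ∈ agreeing Zᶜ w,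
    marginalProb p ({y} ∪ ({x} ∪ Z)) w' / marginalProb p ({x} ∪ Z) w' * marginalProb p Z w'

@[simp]
theorem mem_agreeing : w' ∈ agreeing S w ↔ ∀ i ∈ S, w' i = w i := by simp [agreeing]

theorem agreeing_congr (h : ∀ i ∈ S, w i = w' i) : agreeing S w = agreeing S w' := by
  ext v
  rw [mem_agreeing, mem_agreeing]
  exact forall₂_congr fun i hi => by rw [h i hi]

theorem marginalProb_congr (h : ∀ i ∈ S, w i = w' i) :
    marginalProb p S w = marginalProb p S w' := by
  rw [marginalProb, agreeing_congr h, marginalProb]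

theorem marginalProb_nonneg (hp : ∀ w, 0 ≤ p w) (S : Finset V) (w : V → A) :
    0 ≤ marginalProb p S w := Finset.sum_nonneg fun w _ => hp w

theorem marginalProb_pos (hp : ∀ w, 0 < p w) (S : Finset V) (w : V → A) :
    0 < marginalProb p S w :=
  Finset.sum_pos (fun w _ => hp w) ⟨w, mem_agreeing.2 fun _ _ => rfl⟩

theorem marginalProb_anti (hp : ∀ w, 0 ≤ p w) (h : S ⊆ S') (w : V → A) :
    marginalProb p S' w ≤ marginalProb p S w :=
  Finset.sum_le_sum_of_subset_of_nonneg
    (fun _ hw => mem_agreeing.2 fun i hi => mem_agreeing.1 hw i (h hi)) fun w _ _ => hp w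

theorem adjustedProb_nonneg (hp : ∀ w, 0 ≤ p w) (x y : V) (Z : Finset V) (w : V → A) :
    0 ≤ adjustedProb p x y Z w :=
  Finset.sum_nonneg fun _ _ => mul_nonneg
    (div_nonneg (marginalProb_nonneg hp _ _) (marginalProb_nonneg hp _ _))
    (marginalProb_nonneg hp _ _)

theorem sum_agreeing_comp_equiv (c : A ≃ B) (f : (V → B) → ℝ) (S : Finset V) (w : V → A) :
    ∑ w' ∈ agreeing S w, f (c ∘ w') = ∑ w' ∈ agreeing S (c ∘ w), f w' :=
  Finset.sum_equiv (Equiv.arrowCongr (.refl V) c) (by simp) (by simp [Equiv.arrowCongr])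

theorem adjustedProb_comp_equiv (c : A ≃ B) (p : (V → B) → ℝ) (x y : V) (Z : Finset V)
    (w : V → A) :
    adjustedProb (fun w => p (c ∘ w)) x y Z w = adjustedProb p x y Z (c ∘ w) := by
  have hmarginal : ∀ S w, marginalProb (fun w => p (c ∘ w)) S w = marginalProb p S (c ∘ w) :=
    sum_agreeing_comp_equiv c p
  simp only [adjustedProb, hmarginal]
  exact sum_agreeing_comp_equiv c (fun w => marginalProb p ({y} ∪ ({x} ∪ Z)) w /
    marginalProb p ({x} ∪ Z) w * marginalProb p Z w) Zᶜ w

section Count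

variable [MeasurableSpace A] [MeasurableSingletonClass A]

theorem lmarginal_count (s : Finset V) (f : (V → A) → ℝ≥0∞) (w : V → A) :
    lmarginal (fun _ => Measure.count) s f w = ∑ w' ∈ agreeing sᶜ w, f w' := by
  rw [lmarginal, lintegral_fintype]
  simp only [Measure.pi_singleton, Measure.count_singleton, Finset.prod_const_one, mul_one]
  refine Finset.sum_nbij' (fun y => Function.updateFinset w s y) (fun w' i => w' i) ?_ ?_ ?_ ?_ ?_
  · intro y _
    exact mem_agreeing.2 fun i hi =>
      updateFinset_apply_of_notMem w y (Finset.mem_compl.1 hi)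
  · exact fun _ _ => Finset.mem_univ _
  · intro y _
    funext i
    simp [Function.updateFinset]
  · intro w' hw'
    funext i
    by_cases hi : i ∈ s
    · simp [Function.updateFinset, hi]
    · rw [updateFinset_apply_of_notMem w _ hi, mem_agreeing.1 hw' i (Finset.mem_compl.2 hi)]
  · exact fun _ _ => rfl

theorem marginalDensity_count (hp : ∀ w, 0 ≤ p w) (S : Finset V) (w : V → A) :
    marginalDensity (fun _ => Measure.count) (fun w => ENNReal.ofReal (p w)) S w =
      ENNReal.ofReal (marginalProb p S w) := by
  rw [marginalDensity, lmarginal_count, compl_compl, marginalProb,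
    ENNReal.ofReal_sum_of_nonneg fun w _ => hp w]

theorem lmarginal_condDensity_count (hp : ∀ w, 0 < p w) (x y : V) (Z : Finset V) (w : V → A) :
    lmarginal (fun _ => Measure.count) Z
      (fun w => condDensity (fun _ => Measure.count) (fun w => ENNReal.ofReal (p w))
          {y} ({x} ∪ Z) w *
        marginalDensity (fun _ => Measure.count) (fun w => ENNReal.ofReal (p w)) Z w) w =
      ENNReal.ofReal (adjustedProb p x y Z w) := by
  have hnn : ∀ S w, 0 ≤ marginalProb p S w := marginalProb_nonneg fun w => (hp w).le
  rw [lmarginal_count, adjustedProb, ENNReal.ofReal_sum_of_nonneg]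
  · refine Finset.sum_congr rfl fun w' _ => ?_
    simp only [condDensity, marginalDensity_count fun w => (hp w).le]
    rw [ENNReal.ofReal_mul (div_nonneg (hnn _ _) (hnn _ _)),
      ENNReal.ofReal_div_of_pos (marginalProb_pos hp _ _)]
  · exact fun w' _ => mul_nonneg (div_nonneg (hnn _ _) (hnn _ _)) (hnn _ _)

end Count

theorem tendsto_adjustedProb {p : ℝ → (V → A) → ℝ} (hp : ∀ w, Continuous fun ε => p ε w)
    (hnn : ∀ ε ∈ Set.Ioo (0 : ℝ) 1, ∀ w, 0 ≤ p ε w) (x y : V) (Z : Finset V) (w : V → A)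
    (h0 : ∀ w' ∈ agreeing Zᶜ w, marginalProb (p 0) ({x} ∪ Z) w' = 0 →
      marginalProb (p 0) Z w' = 0) :
    Filter.Tendsto (fun ε => adjustedProb (p ε) x y Z w) (nhdsWithin 0 (Set.Ioi 0))
      (nhds (adjustedProb (p 0) x y Z w)) := by
  have hlim : ∀ S w, Filter.Tendsto (fun ε => marginalProb (p ε) S w) (nhdsWithin 0 (Set.Ioi 0))
      (nhds (marginalProb (p 0) S w)) := fun S w =>
    ((continuous_finsetSum _ fun w' _ => hp w').tendsto 0).mono_left nhdsWithin_le_nhds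
  refine tendsto_finsetSum _ fun w' hw' => ?_
  obtain hx | hx := ne_or_eq (marginalProb (p 0) ({x} ∪ Z) w') 0
  · exact ((hlim _ w').div (hlim _ w') hx).mul (hlim _ w')
  -- The conditional probability need not converge, but it lies in the unit interval.
  have hZ := hlim Z w'
  rw [h0 w' hw' hx] at hZ ⊢
  rw [mul_zero]
  refine squeeze_zero' ?_ ?_ hZ
  all_goals
    filter_upwards [Ioo_mem_nhdsGT (one_pos : (0 : ℝ) < 1)] with ε hε
    have hm := marginalProb_nonneg (hnn ε hε)
  · exact mul_nonneg (div_nonneg (hm _ _) (hm _ _)) (hm _ _)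
  · exact mul_le_of_le_one_left (hm _ _) (div_le_one_of_le₀
      (marginalProb_anti (hnn ε hε) Finset.subset_union_right w') (hm _ _))

end FiniteAlphabet

/-! ### Finite models -/

section FiniteModels

variable {V A B : Type*} [DecidableEq V] [Fintype A] [Fintype B] {D : DAG V}
  {κ : V → (V → A) → ℝ} {x y : V} {Z : Finset V}

/-- Transition probabilities along `D` over a finite alphabet: `κ i w` is the probability of the
value `w i` given the values of the parents of `i` in `w`. Unlike in `DAG.IsKernelFamily`, they are
real numbers, and the reference measure is the counting measure. -/
structure DAG.IsFiniteKernelFamily (D : DAG V) (κ : V → (V → A) → ℝ) : Prop where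
  nonneg : ∀ i w, 0 ≤ κ i w
  dependsOn : ∀ i, DependsOn (κ i) (insert i {j | D.Adj j i})
  sum_update_eq_one : ∀ i w, ∑ a, κ i (Function.update w i a) = 1

/-- The mixture of the transition probabilities `κ` with the uniform distribution. -/
noncomputable def mixUniform (ε : ℝ) (κ : V → (V → A) → ℝ) (i : V) (w : V → A) : ℝ :=
  (1 - ε) * κ i w + ε / Fintype.card A

namespace DAG.IsFiniteKernelFamily

theorem isKernelFamily [Finite V] [MeasurableSpace A] [MeasurableSingletonClass A]
    (hκ : D.IsFiniteKernelFamily κ) :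
    D.IsKernelFamily (fun _ => Measure.count) fun i w => ENNReal.ofReal (κ i w) where
  measurable _ := measurable_of_finite _
  dependsOn i _ _ hw := congrArg ENNReal.ofReal (hκ.dependsOn i hw)
  lmarginal_eq_one i w := by
    simp only [lmarginal_singleton, lintegral_fintype, Measure.count_singleton, mul_one]
    rw [← ENNReal.ofReal_sum_of_nonneg fun a _ => hκ.nonneg i _, hκ.sum_update_eq_one,
      ENNReal.ofReal_one]

theorem comp_equiv (c : B ≃ A) (hκ : D.IsFiniteKernelFamily κ) :
    D.IsFiniteKernelFamily fun i (w : V → B) => κ i (c ∘ w) where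
  nonneg i w := hκ.nonneg i _
  dependsOn i w w' hw := hκ.dependsOn i fun j hj => congrArg c (hw j hj)
  sum_update_eq_one i w := by
    simp only [Function.comp_update]
    rw [Equiv.sum_comp c fun a => κ i (Function.update (c ∘ w) i a), hκ.sum_update_eq_one]

protected theorem mixUniform [Nonempty A] (hκ : D.IsFiniteKernelFamily κ) {ε : ℝ}
    (hε : ε ∈ Set.Icc (0 : ℝ) 1) : D.IsFiniteKernelFamily (mixUniform ε κ) where
  nonneg i w := add_nonneg (mul_nonneg (sub_nonneg.2 hε.2) (hκ.nonneg i w))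
    (div_nonneg hε.1 (Nat.cast_nonneg _))
  dependsOn i w w' hw := by simp only [mixUniform, hκ.dependsOn i hw]
  sum_update_eq_one i w := by
    simp only [mixUniform, Finset.sum_add_distrib, ← Finset.mul_sum, hκ.sum_update_eq_one,
      Finset.sum_const, Finset.card_univ, nsmul_eq_mul]
    field_simp
    ring

theorem mixUniform_pos [Nonempty A] (hκ : D.IsFiniteKernelFamily κ) {ε : ℝ}
    (hε : ε ∈ Set.Ioo (0 : ℝ) 1) (i : V) (w : V → A) : 0 < mixUniform ε κ i w :=
  add_pos_of_nonneg_of_pos (mul_nonneg (sub_nonneg.2 hε.2.le) (hκ.nonneg i w))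
    (div_pos hε.1 (Nat.cast_pos.2 Fintype.card_pos))

variable [Fintype V]

theorem adjustedProb_update_of_pos_of_univ {A : Type u} [Fintype A] [DecidableEq A]
    {κ : V → (V → A) → ℝ} (hκ : D.IsFiniteKernelFamily κ)
    (hpos : ∀ i w, 0 < κ i w) (hZ : IsAdjustmentSet.{_, u} D {x} {y} Z)
    (hx : ∀ i ≠ x, DependsOn (κ i) {x}ᶜ) (w : V → A) (a : A) :
    adjustedProb (fun w => ∏ i, κ i w) x y Z (Function.update w x a) =
      adjustedProb (fun w => ∏ i, κ i w) x y Z w := by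
  let _ : MeasurableSpace A := ⊤
  have : DiscreteMeasurableSpace A := ⟨fun _ => trivial⟩
  have : Nonempty (V → A) := ⟨w⟩
  have hp : ∀ w, 0 < ∏ i, κ i w := fun w => Finset.prod_pos fun i _ => hpos i w
  have hprod : (fun w => ∏ i, ENNReal.ofReal (κ i w)) = fun w => ENNReal.ofReal (∏ i, κ i w) :=
    funext fun w => (ENNReal.ofReal_prod_of_nonneg fun i _ => (hpos i w).le).symm
  obtain ⟨L, hL, hLeq⟩ := hκ.isKernelFamily.exists_dependsOn_compl_ae_eq_adjustment
    (fun i w => ENNReal.ofReal_pos.2 (hpos i w)) hZ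
    fun i hi w w' hw => congrArg ENNReal.ofReal (hx i hi hw)
  simp only [ae_pi_count_iff, hprod, lmarginal_condDensity_count hp] at hLeq
  have hnn := adjustedProb_nonneg (fun w => (hp w).le) x y Z
  rw [← ENNReal.ofReal_eq_ofReal_iff (hnn _) (hnn _), ← hLeq, ← hLeq]
  exact hL fun i hi => Function.update_of_ne hi _ _

variable [DecidableEq A]

theorem adjustedProb_update_of_pos (hκ : D.IsFiniteKernelFamily κ) (hpos : ∀ i w, 0 < κ i w)
    (hZ : IsAdjustmentSet.{_, u} D {x} {y} Z) (hx : ∀ i ≠ x, DependsOn (κ i) {x}ᶜ) (w : V → A)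
    (a : A) :
    adjustedProb (fun w => ∏ i, κ i w) x y Z (Function.update w x a) =
      adjustedProb (fun w => ∏ i, κ i w) x y Z w := by
  classical
  let c : Shrink.{u} A ≃ A := (equivShrink.{u} A).symm
  have hw : c ∘ (c.symm ∘ w) = w := funext fun i => c.apply_symm_apply (w i)
  have h := (hκ.comp_equiv c).adjustedProb_update_of_pos_of_univ (fun i w => hpos i _) hZ
    (fun i hi w w' hw => hx i hi fun j hj => congrArg c (hw j hj)) (c.symm ∘ w) (c.symm a)
  let p : (V → A) → ℝ := fun w => ∏ i, κ i w
  rwa [adjustedProb_comp_equiv c p, adjustedProb_comp_equiv c p,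
    Function.comp_update, hw, c.apply_symm_apply] at h

theorem tendsto_adjustedProb_mixUniform [Nonempty A] (hκ : D.IsFiniteKernelFamily κ) (hxZ : x ∉ Z)
    {w : V → A} (h0 : ∀ w', w' x = w x → marginalProb (fun w => ∏ i, κ i w) ({x} ∪ Z) w' = 0 →
      marginalProb (fun w => ∏ i, κ i w) Z w' = 0) :
    Filter.Tendsto (fun ε => adjustedProb (fun w => ∏ i, mixUniform ε κ i w) x y Z w)
      (nhdsWithin 0 (Set.Ioi 0)) (nhds (adjustedProb (fun w => ∏ i, κ i w) x y Z w)) := by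
  have hzero : κ = mixUniform 0 κ := by
    funext i w
    simp [mixUniform]
  rw [hzero] at h0
  conv => enter [3, 1, 1, w, 2, i]; rw [hzero]
  refine tendsto_adjustedProb (p := fun ε w => ∏ i, mixUniform ε κ i w) (fun w => ?_)
    (fun ε hε w => Finset.prod_nonneg fun i _ => (hκ.mixUniform_pos hε i w).le) x y Z w
    fun w' hw' => h0 w' (mem_agreeing.1 hw' x (Finset.mem_compl.2 hxZ))
  unfold mixUniform
  fun_prop

/-- The weights may have zeros: they are limits of positive ones. -/
theorem adjustedProb_update (hκ : D.IsFiniteKernelFamily κ)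
    (hZ : IsAdjustmentSet.{_, u} D {x} {y} Z) (hx : ∀ i ≠ x, DependsOn (κ i) {x}ᶜ) {w : V → A}
    {a : A} (h0 : ∀ w', w' x = w x ∨ w' x = a →
      marginalProb (fun w => ∏ i, κ i w) ({x} ∪ Z) w' = 0 →
        marginalProb (fun w => ∏ i, κ i w) Z w' = 0) :
    adjustedProb (fun w => ∏ i, κ i w) x y Z (Function.update w x a) =
      adjustedProb (fun w => ∏ i, κ i w) x y Z w := by
  have : Nonempty A := ⟨a⟩
  have hxZ : x ∉ Z := Finset.disjoint_singleton_left.1 hZ.2.1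
  refine tendsto_nhds_unique_of_eventuallyEq
    (hκ.tendsto_adjustedProb_mixUniform hxZ fun w' hw' => h0 w' (.inr ?_))
    (hκ.tendsto_adjustedProb_mixUniform hxZ fun w' hw' => h0 w' (.inl hw')) ?_
  · rw [hw', Function.update_self]
  · filter_upwards [Ioo_mem_nhdsGT (one_pos : (0 : ℝ) < 1)] with ε hε
    refine (hκ.mixUniform (Set.Ioo_subset_Icc_self hε)).adjustedProb_update_of_pos
      (hκ.mixUniform_pos hε) hZ (fun i hi w w' hw => ?_) w a
    simp only [mixUniform, hx i hi hw]

end DAG.IsFiniteKernelFamily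

end FiniteModels

/-! ### Finite structural models -/

section ConditionalMeans

variable {V A : Type*} [Fintype V] [DecidableEq V] [Fintype A] [DecidableEq A]
  {p : (V → A) → ℝ} {x y : V} {S Z : Finset V} {w : V → A}

theorem marginalProb_ne_zero_iff (hp : ∀ w, 0 ≤ p w) :
    marginalProb p S w ≠ 0 ↔ ∃ v ∈ agreeing S w, p v ≠ 0 := by
  rw [marginalProb, Ne, Finset.sum_eq_zero_iff_of_nonneg fun w _ => hp w]
  push Not
  rfl

theorem sum_mul_marginalProb_update (hy : y ∉ S) (φ : A → ℝ) (p : (V → A) → ℝ) (w : V → A) :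
    ∑ a, φ a * marginalProb p ({y} ∪ S) (Function.update w y a) =
      ∑ v ∈ agreeing S w, φ (v y) * p v := by
  have hfiber : ∀ a, agreeing ({y} ∪ S) (Function.update w y a) =
      {v ∈ agreeing S w | v y = a} := by
    intro a
    ext v
    have hne : ∀ i ∈ S, Function.update w y a i = w i := fun i hi =>
      Function.update_of_ne (ne_of_mem_of_not_mem hi hy) _ _
    simp +contextual [hne, and_comm]
  rw [← Finset.sum_fiberwise _ fun v : V → A => v y]
  refine Finset.sum_congr rfl fun a _ => ?_
  rw [marginalProb, hfiber, Finset.mul_sum]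
  exact Finset.sum_congr rfl fun v hv => by rw [(Finset.mem_filter.1 hv).2]

theorem sum_agreeing_compl_mul_marginalProb (f p : (V → A) → ℝ) (Z : Finset V) (w : V → A) :
    ∑ w' ∈ agreeing Zᶜ w, f w' * marginalProb p Z w' = ∑ v, f (Z.piecewise v w) * p v := by
  simp only [marginalProb, Finset.mul_sum]
  rw [Finset.sum_comm' (t' := .univ) (s' := fun v => {Z.piecewise v w})]
  · simp only [Finset.sum_singleton]
  · intro w' v
    simp only [mem_agreeing, Finset.mem_compl, Finset.mem_singleton, Finset.mem_univ, and_true,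
      funext_iff, Finset.piecewise]
    grind

/-- `m` is the conditional mean of `φ` at `y` given the values at `x` and `Z`. -/
theorem sum_mul_adjustedProb (hp : ∀ w, 0 ≤ p w) (hxy : x ≠ y) (hxZ : x ∉ Z) (hyZ : y ∉ Z)
    {φ : A → ℝ} {m : (V → A) → ℝ}
    (hpos : ∀ v, p v ≠ 0 → ∃ v', p v' ≠ 0 ∧ v' x = w x ∧ ∀ i ∈ Z, v' i = v i)
    (hm : ∀ v v', p v ≠ 0 → p v' ≠ 0 → v' x = w x → (∀ i ∈ Z, v' i = v i) → φ (v' y) = m v) :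
    ∑ a, φ a * adjustedProb p x y Z (Function.update w y a) = ∑ v, m v * p v := by
  have hy : y ∉ {x} ∪ Z := by simp [hxy.symm, hyZ]
  simp only [adjustedProb, sum_agreeing_compl_mul_marginalProb, Finset.mul_sum]
  rw [Finset.sum_comm]
  refine Finset.sum_congr rfl fun v _ => ?_
  obtain hv | hv := eq_or_ne (p v) 0
  · simp [hv]
  set u : V → A := Z.piecewise v w with hu
  have hagree : ∀ v', v' ∈ agreeing ({x} ∪ Z) u ↔ v' x = w x ∧ ∀ i ∈ Z, v' i = v i := by
    simp +contextual [hu, hxZ]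
  have hne : marginalProb p ({x} ∪ Z) u ≠ 0 := by
    obtain ⟨v', hv', h⟩ := hpos v hv
    exact (marginalProb_ne_zero_iff hp).2 ⟨v', (hagree v').2 h, hv'⟩
  have hupdate : ∀ a, Z.piecewise v (Function.update w y a) = Function.update u y a := fun a =>
    (Z.update_piecewise_of_notMem v w hyZ a).symm
  have hden : ∀ a, marginalProb p ({x} ∪ Z) (Function.update u y a) =
      marginalProb p ({x} ∪ Z) u := fun a =>
    marginalProb_congr fun i hi => Function.update_of_ne (ne_of_mem_of_not_mem hi hy) _ _
  have hmean : ∑ a, φ a * marginalProb p ({y} ∪ ({x} ∪ Z)) (Function.update u y a) =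
      m v * marginalProb p ({x} ∪ Z) u := by
    rw [sum_mul_marginalProb_update hy, marginalProb, Finset.mul_sum]
    refine Finset.sum_congr rfl fun v' hv' => ?_
    obtain h0 | h0 := eq_or_ne (p v') 0
    · rw [h0, mul_zero, mul_zero]
    · rw [hm v v' hv h0 ((hagree v').1 hv').1 ((hagree v').1 hv').2]
  simp only [hupdate, hden, ← mul_assoc, ← mul_div_assoc, ← Finset.sum_mul, ← Finset.sum_div,
    hmean, mul_div_cancel_right₀ _ hne]

end ConditionalMeans

section StructuralEquations

variable {V E A : Type*} [Fintype E] [DecidableEq A] {D : DAG V} {q : E → ℝ}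
  {g : V → E → (V → A) → A}

/-- The transition probabilities of the structural equations `w i = g i e w`, where the noise `e`
takes its values in `E` with the probabilities `q`. -/
def noiseKernel (q : E → ℝ) (g : V → E → (V → A) → A) (i : V) (w : V → A) : ℝ :=
  ∑ e, if w i = g i e w then q e else 0

theorem noiseKernel_nonneg (hq : ∀ e, 0 ≤ q e) (i : V) (w : V → A) : 0 ≤ noiseKernel q g i w :=
  Finset.sum_nonneg fun e _ => ite_nonneg (hq e) le_rfl

theorem dependsOn_noiseKernel {i : V} {s : Set V} (hi : i ∈ s)
    (hg : ∀ e, DependsOn (g i e) s) : DependsOn (noiseKernel q g i) s := by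
  intro w w' hw
  simp only [noiseKernel]
  exact Finset.sum_congr rfl fun e _ => by rw [hw i hi, hg e hw]

theorem isFiniteKernelFamily_noiseKernel [DecidableEq V] [Fintype A] (hq : ∀ e, 0 ≤ q e)
    (hq1 : ∑ e, q e = 1) (hg : ∀ i e, DependsOn (g i e) {j | D.Adj j i}) :
    D.IsFiniteKernelFamily (noiseKernel q g) where
  nonneg := noiseKernel_nonneg hq
  dependsOn i := dependsOn_noiseKernel (Set.mem_insert _ _) fun e w w' hw =>
    hg i e fun j hj => hw j (.inr hj)
  sum_update_eq_one i w := by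
    have hupdate : ∀ a e, g i e (Function.update w i a) = g i e w := fun a e =>
      hg i e fun j hj => Function.update_of_ne
        (ne_of_mem_of_not_mem hj fun h => D.acyclic i (.single h)) _ _
    simp only [noiseKernel, Function.update_self, hupdate]
    rw [Finset.sum_comm]
    simpa using hq1

variable [Fintype V] {sol : (V → E) → V → A}

theorem prod_noiseKernel_ne_zero_iff (hq : ∀ e, 0 < q e)
    (hsol : ∀ e w, (∀ i, w i = g i (e i) w) ↔ w = sol e) {w : V → A} :
    ∏ i, noiseKernel q g i w ≠ 0 ↔ ∃ e, w = sol e := by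
  have hne : ∀ i, noiseKernel q g i w ≠ 0 ↔ ∃ e, w i = g i e w := by
    intro i
    rw [noiseKernel, Ne, Finset.sum_eq_zero_iff_of_nonneg fun e _ => ite_nonneg (hq e).le le_rfl]
    simp [(hq _).ne']
  rw [Finset.prod_ne_zero_iff]
  simp only [Finset.mem_univ, forall_const, hne, Classical.skolem, hsol]

theorem sum_mul_prod_noiseKernel [DecidableEq V] [Fintype A]
    (hsol : ∀ e w, (∀ i, w i = g i (e i) w) ↔ w = sol e) (f : (V → A) → ℝ) :
    ∑ w, f w * ∏ i, noiseKernel q g i w = ∑ e : V → E, f (sol e) * ∏ i, q (e i) := by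
  simp only [noiseKernel, Finset.prod_univ_sum, Fintype.piFinset_univ, Finset.prod_ite_zero,
    Finset.mem_univ, true_imp_iff, hsol, Finset.mul_sum]
  rw [Finset.sum_comm]
  simp

end StructuralEquations

/-! ### The signal model -/

section Bits

/-- The sign of a bit. -/
def bitSign (b : Bool) : ℝ := if b then -1 else 1

/-- The probability of a bit. It is not uniform, so that the product of the signs of two
independent bits has a nonzero mean. -/
noncomputable def bitProb (b : Bool) : ℝ := if b then 1 / 4 else 3 / 4

theorem bitSign_xor (a b : Bool) : bitSign (a ^^ b) = bitSign a * bitSign b := by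
  cases a <;> cases b <;> simp [bitSign]

theorem bitProb_pos (b : Bool) : 0 < bitProb b := by
  cases b <;> norm_num [bitProb]

theorem sum_bitProb : ∑ b, bitProb b = 1 := by
  norm_num [bitProb]

theorem sum_bitSign_xor_mul_prod_bitProb_pos {V : Type*} [Fintype V] [DecidableEq V] (r r' : V) :
    0 < ∑ e : V → Bool, bitSign (e r ^^ e r') * ∏ i, bitProb (e i) := by
  let sgn (s i : V) (b : Bool) : ℝ := if i = s then bitSign b else 1
  have hfactor : ∀ e : V → Bool, bitSign (e r ^^ e r') * ∏ i, bitProb (e i) =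
      ∏ i, sgn r i (e i) * sgn r' i (e i) * bitProb (e i) := by
    intro e
    simp only [sgn, bitSign_xor, Finset.prod_mul_distrib, Finset.prod_ite_eq',
      Finset.mem_univ, if_true]
  have hprod := Finset.prod_univ_sum (fun _ : V => (Finset.univ : Finset Bool))
    fun i b => sgn r i b * sgn r' i b * bitProb b
  rw [Fintype.piFinset_univ] at hprod
  rw [Finset.sum_congr rfl fun e _ => hfactor e, ← hprod]
  refine Finset.prod_pos fun i _ => ?_
  rw [Fintype.sum_bool]
  unfold sgn
  split_ifs <;> norm_num [bitProb, bitSign]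

end Bits

namespace DAG

section Signals

variable {V : Type*}

open Classical in
/-- Whether the signal of `r` reaches `i` through a parent outside `N`, in the configuration `w`. -/
noncomputable def received (D : DAG V) (N : Set V) (w : V → V → V → Bool) (i r : V) : Bool :=
  decide (∃ p, D.Adj p i ∧ p ∉ N ∧ w p r r)

open Classical in
/-- The structural equations of the signal model, where the noise `b` at `i` is its own signal. The
nodes outside `Z` and `x` transmit all signals that they receive, and their own. An element of `Z`
shows, for any two signals visible to it, whether they differ, and `x` shows the signal of `r₀`. The
values are functions of two nodes; the second one only matters in `Z`. -/
noncomputable def signalEqn (D : DAG V) (x : V) (Z : Set V) (r₀ i : V) (b : Bool)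
    (w : V → V → V → Bool) : V → V → Bool :=
  if i = x then fun _ _ => D.received (insert x Z) w i r₀
  else if i ∈ Z then fun r r' => decide (D.Linked (insert x Z) {i} r r') &&
    (D.received (insert x Z) w i r ^^ D.received (insert x Z) w i r')
  else fun r _ => if r = i then b else D.received (insert x Z) w i r

open Classical in
/-- The solution of the structural equations of the signal model for the signals `e`. -/
noncomputable def signalSol (D : DAG V) (x : V) (Z : Set V) (r₀ : V) (e : V → Bool) (i : V) :
    V → V → Bool :=
  if i = x then fun _ _ => e r₀
  else if i ∈ Z then fun r r' => decide (D.Linked (insert x Z) {i} r r') && (e r ^^ e r')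
  else fun r _ => decide (r ∉ insert x Z ∧ D.Carries (insert x Z) r i) && e r

variable {D : DAG V} {x r₀ : V} {Z : Set V} {e e' : V → Bool}

theorem Carries.notMem {N : Set V} {r i : V} (h : D.Carries N r i) (hr : r ∉ N) : i ∉ N := by
  cases h with
  | refl => exact hr
  | tail _ h => exact h.2

theorem carries_iff_visible {N : Set V} {r i : V} (hi : i ∉ N) (hri : r ≠ i) :
    D.Carries N r i ↔ D.Visible N i r := by
  rw [Carries, Relation.ReflTransGen.cases_tail_iff, or_iff_right hri.symm]
  exact exists_congr fun p => ⟨fun h => ⟨h.2.1, h.1⟩, fun h => ⟨h.2, h.1, hi⟩⟩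

theorem signalSol_self : D.signalSol x Z r₀ e x = fun _ _ => e r₀ := if_pos rfl

open Classical in
theorem signalSol_of_mem (hx : x ∉ Z) {z : V} (hz : z ∈ Z) (r r' : V) :
    D.signalSol x Z r₀ e z r r' =
      (decide (D.Linked (insert x Z) {z} r r') && (e r ^^ e r')) := by
  rw [signalSol, if_neg (ne_of_mem_of_not_mem hz hx), if_pos hz]

open Classical in
theorem signalSol_of_notMem {i : V} (hi : i ∉ insert x Z) (r r' : V) :
    D.signalSol x Z r₀ e i r r' =
      (decide (r ∉ insert x Z ∧ D.Carries (insert x Z) r i) && e r) := by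
  rw [Set.mem_insert_iff, not_or] at hi
  rw [signalSol, if_neg hi.1, if_neg hi.2]

theorem signalSol_eq_of_carries {r i : V} (hr : r ∉ insert x Z) (h : D.Carries (insert x Z) r i) :
    D.signalSol x Z r₀ e i r r = e r := by
  simp [signalSol_of_notMem (h.notMem hr), hr, h]

open Classical in
theorem received_signalSol (i r : V) :
    D.received (insert x Z) (D.signalSol x Z r₀ e) i r =
      (decide (r ∉ insert x Z ∧ D.Visible (insert x Z) i r) && e r) := by
  rw [Bool.eq_iff_iff, received, decide_eq_true_iff, Bool.and_eq_true, decide_eq_true_iff]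
  constructor
  · rintro ⟨p, hpi, hp, hw⟩
    rw [signalSol_of_notMem hp, Bool.and_eq_true, decide_eq_true_iff] at hw
    exact ⟨⟨hw.1.1, p, hpi, hw.1.2⟩, hw.2⟩
  · rintro ⟨⟨hr, p, hpi, hrp⟩, her⟩
    exact ⟨p, hpi, hrp.notMem hr, by rwa [signalSol_eq_of_carries hr hrp]⟩

open Classical in
theorem signalEqn_signalSol (hr₀ : r₀ ∉ insert x Z) (hv : D.Visible (insert x Z) x r₀)
    (e : V → Bool) (i : V) :
    D.signalEqn x Z r₀ i (e i) (D.signalSol x Z r₀ e) = D.signalSol x Z r₀ e i := by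
  simp only [signalEqn, received_signalSol]
  conv_rhs => rw [signalSol]
  refine ite_congr rfl (fun hix => ?_) fun hix => ite_congr rfl (fun _ => ?_) fun hiZ => ?_
  · simp [hix, hr₀, hv]
  · funext r r'
    by_cases h : D.Linked (insert x Z) {i} r r'
    · obtain ⟨hr, hr', z, rfl, hzr, hzr'⟩ := h
      simp [hr, hr', hzr, hzr']
    · simp [h]
  · have hi : i ∉ insert x Z := by simp [hix, hiZ]
    funext r _
    split_ifs with hri
    · subst hri
      have : D.Carries (insert x Z) r r := .refl
      simp [hi, this]
    · simp only [carries_iff_visible hi hri]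

theorem dependsOn_signalEqn (i : V) (b : Bool) :
    DependsOn (D.signalEqn x Z r₀ i b) {p | D.Adj p i ∧ p ∉ insert x Z} := by
  intro w w' h
  have hreceived : D.received (insert x Z) w i = D.received (insert x Z) w' i := by
    funext r
    refine decide_eq_decide.2 (exists_congr fun p => and_congr_right fun hpi =>
      and_congr_right fun hp => ?_)
    rw [h p ⟨hpi, hp⟩]
  simp only [signalEqn, hreceived]

theorem eq_signalEqn_iff [Finite V] (hr₀ : r₀ ∉ insert x Z) (hv : D.Visible (insert x Z) x r₀)
    (e : V → Bool) (w : V → V → V → Bool) :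
    (∀ i, w i = D.signalEqn x Z r₀ i (e i) w) ↔ w = D.signalSol x Z r₀ e := by
  constructor
  · intro h
    funext i
    induction i using D.wellFounded_adj.induction with
    | _ i ih =>
      rw [h i, dependsOn_signalEqn i (e i) fun p hp => ih p hp.1, signalEqn_signalSol hr₀ hv]
  · rintro rfl i
    exact (signalEqn_signalSol hr₀ hv e i).symm

/-- Flipping all signals changes what `x` shows, but not what `Z` shows. -/
theorem exists_signalSol_self_eq (hx : x ∉ Z) (e : V → Bool) (b : Bool) :
    ∃ e', (D.signalSol x Z r₀ e' x = fun _ _ => b) ∧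
      ∀ i ∈ Z, D.signalSol x Z r₀ e' i = D.signalSol x Z r₀ e i := by
  obtain h | h := eq_or_ne (e r₀) b
  · exact ⟨e, by rw [signalSol_self, h], fun _ _ => rfl⟩
  · refine ⟨fun i => !e i, by rw [signalSol_self, Bool.eq_not_of_ne h, Bool.not_not], ?_⟩
    intro i hi
    funext r r'
    rw [signalSol_of_mem hx hi, signalSol_of_mem hx hi, Bool.not_xor_not]

theorem xor_eq_of_reflTransGen_linked (hx : x ∉ Z) {r r' : V}
    (h : Relation.ReflTransGen (D.Linked (insert x Z) Z) r r')
    (heq : ∀ i ∈ Z, D.signalSol x Z r₀ e i = D.signalSol x Z r₀ e' i) :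
    (e r ^^ e r') = (e' r ^^ e' r') := by
  induction h with
  | refl => rw [Bool.xor_self, Bool.xor_self]
  | @tail s s' _ h ih =>
    obtain ⟨hs, hs', z, hz, hzs, hzs'⟩ := h
    have hlinked : D.Linked (insert x Z) {z} s s' := ⟨hs, hs', z, rfl, hzs, hzs'⟩
    have hshown := congrFun₂ (heq z hz) s s'
    simp only [signalSol_of_mem hx hz, hlinked, decide_true, Bool.true_and] at hshown
    have hxor : ∀ a b c : Bool, (a ^^ c) = ((a ^^ b) ^^ (b ^^ c)) := by decide
    rw [hxor (e r) (e s), ih, hshown, ← hxor]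

variable [Fintype V]

/-- The joint probabilities of the signal model. -/
noncomputable def signalLaw (D : DAG V) (x : V) (Z : Set V) (r₀ : V) (w : V → V → V → Bool) : ℝ :=
  ∏ i, noiseKernel bitProb (D.signalEqn x Z r₀) i w

theorem isFiniteKernelFamily_signalEqn [DecidableEq V] (D : DAG V) (x : V) (Z : Set V) (r₀ : V) :
    D.IsFiniteKernelFamily (noiseKernel bitProb (D.signalEqn x Z r₀)) :=
  isFiniteKernelFamily_noiseKernel (fun b => (bitProb_pos b).le) sum_bitProb fun i b =>
    (dependsOn_signalEqn i b).mono fun _ hp => hp.1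

theorem signalLaw_nonneg (w : V → V → V → Bool) : 0 ≤ D.signalLaw x Z r₀ w :=
  Finset.prod_nonneg fun i _ => noiseKernel_nonneg (fun b => (bitProb_pos b).le) i w

theorem signalLaw_ne_zero_iff (hr₀ : r₀ ∉ insert x Z) (hv : D.Visible (insert x Z) x r₀)
    {w : V → V → V → Bool} : D.signalLaw x Z r₀ w ≠ 0 ↔ ∃ e, w = D.signalSol x Z r₀ e :=
  prod_noiseKernel_ne_zero_iff bitProb_pos (eq_signalEqn_iff hr₀ hv)

end Signals

section SignalLaw

variable {V : Type v} [Fintype V] [DecidableEq V] {D : DAG V} {x y r₀ r : V} {Z : Finset V}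
  {w : V → V → V → Bool} {b : Bool}

theorem marginalProb_signalLaw_eq_zero (hr₀ : r₀ ∉ insert x (Z : Set V))
    (hv : D.Visible (insert x Z) x r₀) (hxZ : x ∉ Z) (hw : w x = fun _ _ => b)
    (h : marginalProb (D.signalLaw x Z r₀) ({x} ∪ Z) w = 0) :
    marginalProb (D.signalLaw x Z r₀) Z w = 0 := by
  contrapose! h
  obtain ⟨v, hvw, hne⟩ := (marginalProb_ne_zero_iff signalLaw_nonneg).1 h
  obtain ⟨e, rfl⟩ := (signalLaw_ne_zero_iff hr₀ hv).1 hne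
  obtain ⟨e', hx, hZ⟩ := D.exists_signalSol_self_eq (r₀ := r₀) (Z := Z) (by simpa) e b
  refine (marginalProb_ne_zero_iff signalLaw_nonneg).2
    ⟨D.signalSol x Z r₀ e', ?_, (signalLaw_ne_zero_iff hr₀ hv).2 ⟨e', rfl⟩⟩
  rw [mem_agreeing] at hvw ⊢
  simp +contextual [hx, hw, hZ, hvw]

theorem adjustedProb_signalLaw_update (hr₀ : r₀ ∉ insert x (Z : Set V))
    (hv : D.Visible (insert x Z) x r₀) (hZ : IsAdjustmentSet.{v, u} D {x} {y} Z)
    (hw : w x = fun _ _ => b) (b' : Bool) :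
    adjustedProb (D.signalLaw x Z r₀) x y Z (Function.update w x fun _ _ => b') =
      adjustedProb (D.signalLaw x Z r₀) x y Z w := by
  have hxZ : x ∉ Z := Finset.disjoint_singleton_left.1 hZ.2.1
  refine (D.isFiniteKernelFamily_signalEqn x Z r₀).adjustedProb_update hZ
    (fun i hi => dependsOn_noiseKernel hi fun b => (dependsOn_signalEqn i b).mono ?_) ?_
  · rintro p hp rfl
    exact hp.2 (Set.mem_insert _ _)
  · rintro w' (hw' | hw')
    · exact marginalProb_signalLaw_eq_zero hr₀ hv hxZ (hw'.trans hw)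
    · exact marginalProb_signalLaw_eq_zero hr₀ hv hxZ hw'

theorem sum_bitSign_mul_adjustedProb_signalLaw (hr₀ : r₀ ∉ insert x (Z : Set V))
    (hv : D.Visible (insert x Z) x r₀) (hxy : x ≠ y) (hxZ : x ∉ Z) (hyZ : y ∉ Z)
    (hlink : Relation.ReflTransGen (D.Linked (insert x Z) Z) r₀ r)
    (hr : r ∉ insert x (Z : Set V)) (hry : D.Carries (insert x Z) r y)
    (hw : w x = fun _ _ => b) :
    ∑ a, bitSign (a r r) *
        adjustedProb (D.signalLaw x Z r₀) x y Z (Function.update w y a) =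
      bitSign b * ∑ e : V → Bool, bitSign (e r₀ ^^ e r) * ∏ i, bitProb (e i) := by
  have hne := fun v => signalLaw_ne_zero_iff hr₀ hv (w := v)
  have hxZ' : x ∉ (Z : Set V) := by simpa
  have hr₀sol : ∀ e, D.signalSol x Z r₀ e r₀ r₀ r₀ = e r₀ := fun e =>
    signalSol_eq_of_carries hr₀ .refl
  have hrsol : ∀ e, D.signalSol x Z r₀ e y r r = e r := fun e => signalSol_eq_of_carries hr hry
  rw [sum_mul_adjustedProb (m := fun v => bitSign b * bitSign (v r₀ r₀ r₀ ^^ v y r r))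
    signalLaw_nonneg hxy hxZ hyZ]
  · simp only [signalLaw]
    rw [sum_mul_prod_noiseKernel (eq_signalEqn_iff hr₀ hv), Finset.mul_sum]
    simp only [hr₀sol, hrsol, mul_assoc]
  · intro v hv
    obtain ⟨e, rfl⟩ := (hne v).1 hv
    obtain ⟨e', hx, hZ⟩ := D.exists_signalSol_self_eq (r₀ := r₀) hxZ' e b
    exact ⟨_, (hne _).2 ⟨e', rfl⟩, hx.trans hw.symm, hZ⟩
  · intro v v' hv hv' hx hZ
    obtain ⟨e, rfl⟩ := (hne v).1 hv
    obtain ⟨e', rfl⟩ := (hne v').1 hv'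
    have hb : e' r₀ = b := by
      rw [hw, signalSol_self] at hx
      exact congrFun₂ hx x x
    rw [hr₀sol, hrsol, hrsol, ← xor_eq_of_reflTransGen_linked hxZ' hlink hZ, hb, ← bitSign_xor,
      ← Bool.xor_assoc, Bool.xor_self, Bool.false_xor]

end SignalLaw

end DAG

/-- In the signal model `x` has no effect, but if `Z` does not separate `x` from `y`, then after
adjusting for `Z` the mean of the sign of some signal at `y` still depends on the value at `x`. -/
theorem IsAdjustmentSet.not_moralConn {V : Type v} [Fintype V] [DecidableEq V] {D : DAG V}
    {x y : V} {Z : Finset V} (hZ : IsAdjustmentSet.{v, u} D {x} {y} Z) :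
    ¬ MoralConn (D.BackdoorAdj x) (ancestralSet (D.BackdoorAdj x) ({x, y} ∪ Z)) Z x y := by
  intro hconn
  have hxy : x ≠ y := by simpa using hZ.1
  have hxZ : x ∉ Z := by simpa using hZ.2.1
  have hyZ : y ∉ Z := by simpa using hZ.2.2.1
  obtain ⟨r, hlinked, hry⟩ := DAG.exists_linkedTo_carries hxy hconn
  have hr := hlinked.notMem
  obtain ⟨r₀, hr₀, hv, hlink⟩ := hlinked
  have hmean := fun w b => DAG.sum_bitSign_mul_adjustedProb_signalLaw hr₀ hv hxy hxZ hyZ hlink hr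
    hry (w := w) (b := b)
  let w : V → V → V → Bool := fun _ _ _ => false
  have hinvariant : ∀ a, adjustedProb (D.signalLaw x Z r₀) x y Z
      (Function.update (Function.update w x fun _ _ => true) y a) =
        adjustedProb (D.signalLaw x Z r₀) x y Z (Function.update w y a) := by
    intro a
    rw [Function.update_comm hxy]
    exact DAG.adjustedProb_signalLaw_update hr₀ hv hZ (Function.update_of_ne hxy _ _) true
  have hfalse := hmean w false rfl
  have htrue := hmean (Function.update w x fun _ _ => true) true (Function.update_self _ _ _)
  simp only [hinvariant, hfalse] at htrue
  have hpos := sum_bitSign_xor_mul_prod_bitProb_pos r₀ r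
  have hsign : bitSign false = 1 ∧ bitSign true = -1 := by simp [bitSign]
  rw [hsign.1, hsign.2] at htrue
  linarith

/-! ### Criteria for minimality -/

section Minimality

variable {V : Type v} [Fintype V] [DecidableEq V] {Ω : V → Type u}
  [∀ i, MeasurableSpace (Ω i)] {μ : ∀ i, Measure (Ω i)} {D : DAG V} {X Y : V} {T : Finset V}

theorem condIndepDensity_congr_right {f : (∀ i, Ω i) → ℝ≥0∞} {A B B' C : Finset V}
    (h : B ∪ C = B' ∪ C) : CondIndepDensity μ f A B C ↔ CondIndepDensity μ f A B' C := by
  simp only [CondIndepDensity, Finset.union_assoc, h]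

-- Faithfulness turns the independence of the one density `f` into a d-separation, which gives the
-- same independence for every density that is compatible with the DAG.
theorem IsAdjustmentSet.of_condIndepDensity {f : (∀ i, Ω i) → ℝ≥0∞} (hf : D.IsFaithful μ f)
    {X Y Z : Finset V} (hT : IsAdjustmentSet.{v, u} D X Y T) (hZT : Z ⊆ T)
    (h : CondIndepDensity μ f Y T (Z ∪ X) ∨ CondIndepDensity μ f X T Z) :
    IsAdjustmentSet.{v, u} D X Y Z := by
  obtain ⟨hXY, hXT, hYT, hT⟩ := hT
  refine ⟨hXY, hXT.mono_right hZT, hYT.mono_right hZT, fun Ω' _ μ' _ F hF hD => ?_⟩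
  refine AdjustmentFormula.of_condIndepDensity hF hXT hYT hZT ?_ (hT Ω' μ' F hF hD)
  have hTZ : T ∪ Z = T \ Z ∪ Z := Finset.sdiff_union_self_eq_union.symm
  have hTZX : T ∪ (Z ∪ X) = T \ Z ∪ (Z ∪ X) := by
    rw [← Finset.union_assoc, ← Finset.union_assoc, hTZ]
  have hYT' : Disjoint Y (T \ Z) := hYT.mono_right Finset.sdiff_subset
  have hXT' : Disjoint X (T \ Z) := hXT.mono_right Finset.sdiff_subset
  rcases h with h | h
  · have hYZX : Disjoint Y (Z ∪ X) :=
      Finset.disjoint_union_right.2 ⟨hYT.mono_right hZT, hXY.symm⟩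
    have hsep := hf Y (T \ Z) (Z ∪ X) hYT' hYZX
      (Finset.disjoint_union_right.2 ⟨Finset.sdiff_disjoint, hXT'.symm⟩)
      ((condIndepDensity_congr_right hTZX).1 h)
    exact Or.inl ((condIndepDensity_congr_right hTZX).2 (hsep.condIndepDensity hF hD hYZX))
  · have hXZ : Disjoint X Z := hXT.mono_right hZT
    have hsep := hf X (T \ Z) Z hXT' hXZ Finset.sdiff_disjoint
      ((condIndepDensity_congr_right hTZ).1 h)
    exact Or.inr ((condIndepDensity_congr_right hTZ).2 (hsep.condIndepDensity hF hD hXZ))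

theorem IsMinimalAdjustmentSet.not_condIndepDensity {f : (∀ i, Ω i) → ℝ≥0∞}
    (hf : D.IsFaithful μ f) {X Y : Finset V} (hT : IsMinimalAdjustmentSet.{v, u} D X Y T) {t : V}
    (ht : t ∈ T) :
    ¬ CondIndepDensity μ f X {t} (T \ {t}) ∧ ¬ CondIndepDensity μ f Y {t} ((T \ {t}) ∪ X) := by
  have hsub : T \ {t} ⊆ T := Finset.sdiff_subset
  have hssub : T \ {t} ⊂ T := Finset.sdiff_ssubset (by simpa using ht) (by simp)
  have hunion : {t} ∪ (T \ {t}) = T ∪ (T \ {t}) := by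
    rw [Finset.union_sdiff_of_subset (by simpa using ht), Finset.union_eq_left.2 hsub]
  have hunion' : {t} ∪ ((T \ {t}) ∪ X) = T ∪ ((T \ {t}) ∪ X) := by
    rw [← Finset.union_assoc, ← Finset.union_assoc, hunion]
  rw [condIndepDensity_congr_right hunion, condIndepDensity_congr_right hunion']
  exact ⟨fun h => hT.2 _ hssub (hT.1.of_condIndepDensity hf hsub (Or.inr h)),
    fun h => hT.2 _ hssub (hT.1.of_condIndepDensity hf hsub (Or.inl h))⟩

variable [∀ i, SigmaFinite (μ i)] {F : Finset V → (∀ i, Ω i) → ℝ≥0∞}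

theorem DAG.IsCompatible.moralConn_backdoorAdj_left (hD : D.IsCompatible μ F)
    (hF : IsInterventionalFamily μ F) (hTX : D.Precedes T {X}) (hXT : X ∉ T) {t : V} (ht : t ∈ T)
    (h : ¬ CondIndepDensity μ (F ∅) {X} {t} (T \ {t})) :
    MoralConn (D.BackdoorAdj X) (ancestralSet (D.BackdoorAdj X) ({X, Y} ∪ (T : Set V)))
      ((T : Set V) \ {t}) X t := by
  by_contra hsep
  refine h (hD.condIndepDensity hF (by simp [hXT]) ?_)
  simp only [Finset.mem_singleton, forall_eq, Finset.coe_singleton, Finset.coe_sdiff]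
  intro hconn
  have hsub : {X} ∪ {t} ∪ (T : Set V) \ {t} ⊆ {X} ∪ (T : Set V) := by grind
  have hconn' := DAG.moralConn_backdoorAdj_of_not_isAncestor
    (fun t ht => hTX t ht X (Finset.mem_singleton_self X))
    (hconn.mono (ancestralSet_mono hsub) subset_rfl)
  exact hsep (hconn'.mono (ancestralSet_mono (by grind)) subset_rfl)

theorem DAG.IsCompatible.moralConn_backdoorAdj_right (hD : D.IsCompatible μ F)
    (hF : IsInterventionalFamily μ F) (hXY : X ≠ Y) (hYT : Y ∉ T) {t : V} (ht : t ∈ T)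
    (h : ¬ CondIndepDensity μ (F ∅) {Y} {t} ((T \ {t}) ∪ {X})) :
    MoralConn (D.BackdoorAdj X) (ancestralSet (D.BackdoorAdj X) ({X, Y} ∪ (T : Set V)))
      ((T : Set V) \ {t}) Y t := by
  by_contra hsep
  refine h (hD.condIndepDensity hF (by simp [hYT, hXY.symm]) ?_)
  simp only [Finset.mem_singleton, forall_eq, Finset.coe_singleton, Finset.coe_union,
    Finset.coe_sdiff]
  intro hconn
  have hconn' := DAG.moralConn_backdoorAdj_of_mem (x := X) (by simp) (by simp) hconn
  exact hsep (hconn'.mono (ancestralSet_mono (by grind)) Set.subset_union_left)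

theorem IsAdjustmentSet.isMinimalAdjustmentSet (hF : IsInterventionalFamily μ F)
    (hD : D.IsCompatible μ F) (hT : IsAdjustmentSet.{v, u} D {X} {Y} T)
    (hTX : D.Precedes T {X})
    (h : ∀ t ∈ T, ¬ CondIndepDensity μ (F ∅) {X} {t} (T \ {t}) ∧
      ¬ CondIndepDensity μ (F ∅) {Y} {t} ((T \ {t}) ∪ {X})) :
    IsMinimalAdjustmentSet.{v, u} D {X} {Y} T := by
  refine ⟨hT, fun Z hZT hZ => hZ.not_moralConn ?_⟩
  have hXY : X ≠ Y := by simpa using hT.1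
  have hXT : X ∉ T := by simpa using hT.2.1
  have hYT : Y ∉ T := by simpa using hT.2.2.1
  exact MoralConn.of_ssubset (DAG.BackdoorAdj.acyclic X) (T := (T : Set V)) (by simpa) (by simpa)
    (by exact_mod_cast hZT)
    (fun t ht => hD.moralConn_backdoorAdj_left hF hTX hXT ht (h t ht).1)
    (fun t ht => hD.moralConn_backdoorAdj_right hF hXY hYT ht (h t ht).2) hT.not_moralConn

end Minimality

theorem lemma2_general {V : Type v} [Fintype V] [DecidableEq V] {Ω : V → Type u}
    [∀ i, MeasurableSpace (Ω i)] {μ : ∀ i, Measure (Ω i)} [∀ i, SigmaFinite (μ i)]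
    {D : DAG V} {F : Finset V → (∀ i, Ω i) → ℝ≥0∞} (hF : IsInterventionalFamily μ F)
    (hD : D.IsCompatible μ F) (hf : D.IsFaithful μ (F ∅)) {X Y : V} {T : Finset V}
    (hT : IsAdjustmentSet.{v, u} D {X} {Y} T) (hTX : D.Precedes T {X}) :
    (IsMinimalAdjustmentSet.{v, u} D {X} {Y} T ↔
      ∀ t ∈ T, ¬ CondIndepDensity μ (F ∅) {X} {t} (T \ {t}) ∧
        ¬ CondIndepDensity μ (F ∅) {Y} {t} ((T \ {t}) ∪ {X})) ∧
    ∀ Z ⊆ T,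
      (∀ z ∈ Z, ¬ CondIndepDensity μ (F ∅) {X} {z} (Z \ {z}) ∧
        ¬ CondIndepDensity μ (F ∅) {Y} {z} ((Z \ {z}) ∪ {X})) →
      (CondIndepDensity μ (F ∅) {Y} T (Z ∪ {X}) ∨ CondIndepDensity μ (F ∅) {X} T Z) →
      IsMinimalAdjustmentSet.{v, u} D {X} {Y} Z := by
  refine ⟨⟨fun hmin t ht => hmin.not_condIndepDensity hf ht,
    hT.isMinimalAdjustmentSet hF hD hTX⟩, fun Z hZT hZ hindep => ?_⟩
  have hZadj : IsAdjustmentSet.{v, u} D {X} {Y} Z := hT.of_condIndepDensity hf hZT hindep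
  exact hZadj.isMinimalAdjustmentSet hF hD (fun z hz => hTX z (hZT hz)) hZ

theorem lemma2 {V : Type v} [Fintype V] [DecidableEq V] {Ω : V → Type u}
    [∀ i, MeasurableSpace (Ω i)] (μ : ∀ i, Measure (Ω i)) [∀ i, SigmaFinite (μ i)]
    (M : StructuralModel V Ω) (F : Finset V → (∀ i, Ω i) → ℝ≥0∞) (hM : M.IsCausalModel μ F)
    (X Y : V) (T : Finset V)
    (hT : IsAdjustmentSet.{v, u} M.D {X} {Y} T) (hTX : M.D.Precedes T {X}) :
    (IsMinimalAdjustmentSet.{v, u} M.D {X} {Y} T ↔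
      ∀ t ∈ T, ¬ CondIndepDensity μ (F ∅) {X} {t} (T \ {t}) ∧
        ¬ CondIndepDensity μ (F ∅) {Y} {t} ((T \ {t}) ∪ {X})) ∧
    (¬ IsMinimalAdjustmentSet.{v, u} M.D {X} {Y} T →
      ∀ Z ⊂ T,
        (∀ z ∈ Z, ¬ CondIndepDensity μ (F ∅) {X} {z} (Z \ {z}) ∧
          ¬ CondIndepDensity μ (F ∅) {Y} {z} ((Z \ {z}) ∪ {X})) →
        (CondIndepDensity μ (F ∅) {Y} T (Z ∪ {X}) ∨ CondIndepDensity μ (F ∅) {X} T Z) →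
        IsMinimalAdjustmentSet.{v, u} M.D {X} {Y} Z) :=
  have h := lemma2_general hM.induces.isInterventionalFamily hM.compatible hM.faithful hT hTX
  ⟨h.1, fun _ Z hZ => h.2 Z hZ.subset⟩
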